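/- Let $\alpha\in(0,2)$ and $a\in(0,1)$, and let $S_0,S_1,S_2,S_3$ be i.i.d. real random variables with the symmetric $\alpha$-stable law $S_\alpha$, i.e. $\mathbb E[e^{itS_0}]=e^{-|t|^\alpha}$ for $t\in\mathbb R$. Let $C_\alpha:=\frac{2}{\pi}\Gamma(\alpha)\sin(\pi\alpha/2)$ (equivalently $\frac{1-\alpha}{\Gamma(2-\alpha)\cos(\pi\alpha/2)}$ for $\alpha\ne1$ and $2/\pi$ for $\alpha=1$), put $$X_i:=aS_0+(1-a^\alpha)^{1/\alpha}S_i\quad(i=1,2,3),\qquad X:=(X_1,X_2,X_3),$$ $$E:=\{\mathbf x\in\mathbb R^3: x_1>1,\ x_2>1,\ x_3<1\},$$ and let $\Lambda$ be the measure on the unit sphere $\mathbb S^2$ with mass $a^\alpha 3^{\alpha/2}/2$ at each of $\pm(1,1,1)/\sqrt3$ and mass $(1-a^\alpha)/2$ at each of $\pm(1,0,0),\pm(0,1,0),\pm(0,0,1)$. For a Borel set $F\subseteq\mathbb R^3$ and an integer $k\ge1$ let $$L(F,k,\alpha):=\frac{C_\alpha^k}{k!}\int_0^\infty\!\!\cdots\int_0^\infty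 \Lambda^k\Bigl(\Bigl\{(\mathbf x_1,\dots,\mathbf x_k)\in(\mathbb S^2)^k:\ \sum_{i=1}^k s_i\mathbf x_i\in F\Bigr\}\Bigr)\prod_{i=1}^k\alpha s_i^{-(1+\alpha)}\,ds_i\ \in[0,\infty],$$ let $E_{\delta,+}:=\{\mathbf x: d(\mathbf x,E)<\delta\}$ with $d$ the Euclidean distance, and let $E^o$ and $\bar E$ be the interior and the closure of $E$. Then the following hold. 1. $C_\alpha>0$ is the tail constant of $S_\alpha$: $\lim_{h\to\infty}h^\alpha P(S_0\ge h)=C_\alpha/2$. The measure $\Lambda$ is a spectral measure of $X$: it is finite, invariant under $\mathbf x\mapsto-\mathbf x$, and $\mathbb E[e^{i\theta\cdot X}]=\exp\bigl(-\int_{\mathbb S^2}|\theta\cdot\mathbf x|^\alpha\,d\Lambda(\mathbf x)\bigr)$ for all $\theta\in\mathbb R^3$. 2. If $\alpha\in(0,1)$, then $$\lim_{h\to\infty}h^{2\alpha}P(X\in hE)=\frac{C_\alpha^2}{4}\Bigl((1-a^\alpha)^2+a^\alpha(1-a^\alpha)\cdot\frac{\alpha\,\Gamma(2\alpha)\,\Gamma(1-\alpha)}{\Gamma(1+\alpha)}\Bigr)<\infty.$$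 3. For every $\alpha\in(0,2)$, $\lim_{\delta\downarrow0}L(E_{\delta,+},2,\alpha)=\infty$ and $L(E^o,2,\alpha)=L(\bar E,2,\alpha)$. This common value is $\infty$ if $\alpha\in[1,2)$, and it equals the right-hand side of the formula in part 2 if $\alpha\in(0,1)$. -/

import Mathlib

open MeasureTheory ProbabilityTheory Filter Topology
open scoped ENNReal Pointwise

noncomputable section

/-- `ℝⁿ` with its Euclidean norm. -/
abbrev RVec (n : ℕ) : Type := EuclideanSpace ℝ (Fin n)

/-- The unit sphere of `ℝⁿ`. -/
abbrev USphere (n : ℕ) : Type := Metric.sphere (0 : RVec n) 1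

/-- `μ` is the one-dimensional symmetric `α`-stable law `S_α` with scale parameter one:
its characteristic function is `t ↦ exp (-|t| ^ α)`. -/
def IsStdStable (α : ℝ) (μ : Measure ℝ) : Prop :=
  IsProbabilityMeasure μ ∧ ∀ t : ℝ, charFun μ t = ((Real.exp (-(|t| ^ α)) : ℝ) : ℂ)

/-- `Λ` is a spectral measure of the symmetric `α`-stable law `μ` on `ℝⁿ`: a finite measure on
the unit sphere, invariant under `x ↦ -x`, such that
the characteristic function of `μ` is `θ ↦ exp (- ∫ |θ ⬝ x| ^ α dΛ(x))`. -/
structure IsSpectralMeasure {n : ℕ} (α : ℝ) (μ : Measure (RVec n)) (Λ : Measure (USphere n)) :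
    Prop where
  finite : IsFiniteMeasure Λ
  symm : Λ.map (fun x => -x) = Λ
  charFun_eq : ∀ θ : RVec n,
    charFun μ θ = ((Real.exp (-∫ x : USphere n, |inner ℝ θ (x : RVec n)| ^ α ∂Λ) : ℝ) : ℂ)

/-- The constant `C_α` of the tail `P(S ≥ h) ∼ C_α h ^ (-α) / 2` of `S ∼ S_α`, `0 < α < 2`.
It equals `(1 - α) / (Γ(2 - α) cos (π α / 2))` for `α ≠ 1`, and `2 / π` for `α = 1`. -/
def tailConst (α : ℝ) : ℝ :=
  2 / Real.pi * Real.Gamma α * Real.sin (Real.pi * α / 2)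

/-- `L(E, k, α)` for the spectral measure `Λ`; it takes values in `[0, ∞]`. -/
def tailL {n : ℕ} (Λ : Measure (USphere n)) (E : Set (RVec n)) (k : ℕ) (α : ℝ) : ℝ≥0∞ :=
  ENNReal.ofReal (tailConst α ^ k / (k.factorial : ℝ)) *
    ∫⁻ s in Set.univ.pi (fun _ : Fin k => Set.Ioi (0 : ℝ)),
      Measure.pi (fun _ : Fin k => Λ)
          {x : Fin k → USphere n | ∑ i, s i • (x i : RVec n) ∈ E} *
        ∏ i, ENNReal.ofReal (α * s i ^ (-(1 + α)))

/-- The unit vector `(1, 1, 1) / √3`. -/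
def diagDir : USphere 3 :=
  ⟨(Real.sqrt 3)⁻¹ • WithLp.toLp 2 (fun _ : Fin 3 => (1 : ℝ)), by
    rw [mem_sphere_zero_iff_norm, norm_smul, EuclideanSpace.norm_eq]
    have h : Real.sqrt 3 ≠ 0 := by positivity
    simp [abs_of_nonneg (Real.sqrt_nonneg 3), h]⟩

/-- The standard unit vectors of `ℝ³`. -/
def axisDir (i : Fin 3) : USphere 3 :=
  ⟨EuclideanSpace.single i (1 : ℝ), by simp⟩

/-- The measure with mass `a ^ α 3 ^ (α / 2) / 2` at `± (1, 1, 1) / √3` and mass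
`(1 - a ^ α) / 2` at each of `± (1, 0, 0)`, `± (0, 1, 0)`, `± (0, 0, 1)`. -/
def spectralMeas (α a : ℝ) : Measure (USphere 3) :=
  ENNReal.ofReal (a ^ α * 3 ^ (α / 2) / 2) •
      (Measure.dirac diagDir + Measure.dirac (-diagDir)) +
    ENNReal.ofReal ((1 - a ^ α) / 2) •
      ∑ i : Fin 3, (Measure.dirac (axisDir i) + Measure.dirac (-axisDir i))

/-- The random vector with coordinates `X_i = a S_0 + (1 - a ^ α) ^ (1 / α) S_i`, `i = 1, 2, 3`
(coordinate `i - 1` of `RVec 3`). -/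
def vecX {Ω : Type*} (α a : ℝ) (S : Fin 4 → Ω → ℝ) (ω : Ω) : RVec 3 :=
  WithLp.toLp 2 (fun i : Fin 3 => a * S 0 ω + (1 - a ^ α) ^ (1 / α) * S i.succ ω)

/-- The set `{x : x_1 > 1, x_2 > 1, x_3 < 1}` (coordinates are numbered from zero here). -/
def setE : Set (RVec 3) := {x | 1 < x 0 ∧ 1 < x 1 ∧ x 2 < 1}

/-- The limiting constant. -/
def limitConst (α a : ℝ) : ℝ :=
  tailConst α ^ 2 / 4 *
    ((1 - a ^ α) ^ 2 + a ^ α * (1 - a ^ α) *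
      (α * Real.Gamma (2 * α) * Real.Gamma (1 - α) / Real.Gamma (1 + α)))

end

/-! ### Explicit integrals: the constant `C_α` and the Beta integral. -/

section Integrals

open Set

/-! Tail of `S_α`. The Lévy measure, with density `α C_α |x| ^ (-(1 + α)) / 2`, is infinite near
`0`, so it is weighted by `1 - exp (-x² / 2)`. Since `exp (-x² / 2)` is the mean of `cos (U x)` for
a standard Gaussian `U`, this weighting acts on Fourier transforms as a difference with a Gaussian
average. The law of `S / h`, weighted in the same way and multiplied by `h ^ α`, has the transform
`h ^ α (φ(t / h) - E φ((t + U) / h))` with `φ(t) = exp (-|t| ^ α)`, which tends to `E |t + U| ^ α -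
|t| ^ α`, the transform of the weighted Lévy measure. The continuity theorem gives weak convergence,
and ramp functions squeeze the tail. The constant comes from `∫₀^∞ (1 - cos x) x ^ (-(1 + α)) dx = 1
/ (α C_α)`.

Density for `α < 1`. Here `exp (-t ^ α)` is convex on `(0, ∞)`, so by Pólya's argument it is a
mixture of tents `(s - |t|)₊`, weighted by its second derivative. Tents are transforms of Fejér
kernels, so `S_α` has an explicit density `f`. Scaling the mixture gives `x ^ (1 + α) f(x) → α C_α /
2` together with a uniform bound.

Decay of `P(X ∈ hE)` for `α < 1`. With `T` the tail function and `b = (1 - a ^ α) ^ (1 / α)`,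
conditioning on `S_0 = s` gives the integral of `f(s) T(y)² T(-y)`, where `y = (h - a s) / b`. There
are two ways to make two large jumps. Either `S_0` stays moderate and both `S_1`, `S_2` are large,
which contributes `(b ^ α C_α / 2)²`. Or `S_0` is of order `h`, say `s = h v / a` with `v > 1`, and
`S_3` is very negative, which contributes `∫₁^∞ v ^ (-(1 + α)) (v - 1) ^ (-α) dv = B(2α, 1 - α)`.
Dominated convergence works because `|v - 1| ^ (-α)` is integrable at `1` exactly when `α < 1`.

The functional `L`. For `k = 2` it is a sum over pairs of atoms of `Λ`. Up to order, only `(e₁, e₂)`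
and `(d, -e₃)`, with `d` the diagonal direction, reach `E`; these are the same two scenarios, and
the second diverges for `α ≥ 1`. The faces of `E` are null for every pair, so interior and closure
agree. Any thickening of `E` contains a neighbourhood of the corner `(1, 1, 1)` on the ray of `d`;
there one large jump along `d` and an arbitrarily small second jump suffice, and the infinite mass
of small jumps makes `L` infinite. -/

theorem lintegral_lintegral_mul_swap {μ ν : Measure ℝ} [SFinite μ] [SFinite ν]
    {A B : ℝ → ℝ≥0∞} {K : ℝ → ℝ → ℝ≥0∞}
    (hA : Measurable A) (hB : Measurable B) (hK : Measurable (Function.uncurry K)) :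
    ∫⁻ x, A x * ∫⁻ s, B s * K x s ∂ν ∂μ = ∫⁻ s, B s * ∫⁻ x, A x * K x s ∂μ ∂ν := by
  have h1 : ∀ x, A x * ∫⁻ s, B s * K x s ∂ν = ∫⁻ s, A x * (B s * K x s) ∂ν := fun x =>
    (lintegral_const_mul _ (by fun_prop)).symm
  have h2 : ∀ s, B s * ∫⁻ x, A x * K x s ∂μ = ∫⁻ x, B s * (A x * K x s) ∂μ := fun s =>
    (lintegral_const_mul _ (by fun_prop)).symm
  simp_rw [h1, h2]
  rw [lintegral_lintegral_swap (by fun_prop)]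
  simp_rw [mul_left_comm]

theorem integrableOn_and_lintegral_Ioi_of_hasDerivAt {F F' : ℝ → ℝ} {a l : ℝ}
    (hcont : ContinuousWithinAt F (Ici a) a) (hderiv : ∀ x ∈ Ioi a, HasDerivAt F (F' x) x)
    (hnonneg : ∀ x ∈ Ioi a, 0 ≤ F' x) (hl : Tendsto F atTop (𝓝 l)) :
    IntegrableOn F' (Ioi a) ∧ ∫⁻ x in Ioi a, ENNReal.ofReal (F' x) = ENNReal.ofReal (l - F a) := by
  have h1 := integrableOn_Ioi_deriv_of_nonneg hcont hderiv hnonneg hl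
  refine ⟨h1, ?_⟩
  rw [← ofReal_integral_eq_lintegral_ofReal h1, integral_Ioi_of_hasDerivAt_of_nonneg hcont hderiv hnonneg hl]
  exact (ae_restrict_iff' measurableSet_Ioi).2 (ae_of_all _ hnonneg)

theorem lintegral_rpow_mul_exp {p r : ℝ} (hp : 0 < p) (hr : 0 < r) :
    ∫⁻ x in Ioi (0 : ℝ), ENNReal.ofReal (x ^ (p - 1) * Real.exp (-(r * x)))
      = ENNReal.ofReal (Real.Gamma p * r ^ (-p)) := by
  have h := Real.integral_rpow_mul_exp_neg_mul_Ioi hp hr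
  have hpos : 0 < Real.Gamma p := Real.Gamma_pos_of_pos hp
  rw [← ofReal_integral_eq_lintegral_ofReal, h]
  · rw [one_div, Real.inv_rpow hr.le, Real.rpow_neg hr.le, mul_comm]
  -- Integrability follows from the known value: a non-integrable function would have integral `0`,
  -- but the value is positive.
  · by_contra hc
    rw [integral_undef hc] at h
    have : 0 < (1 / r) ^ p * Real.Gamma p := by positivity
    linarith
  · refine (ae_restrict_iff' measurableSet_Ioi).2 (ae_of_all _ fun x hx => ?_)
    have : 0 < x := hx
    positivity

theorem lintegral_exp_neg_mul {r : ℝ} (hr : 0 < r) :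
    ∫⁻ x in Ioi (0 : ℝ), ENNReal.ofReal (Real.exp (-(r * x))) = ENNReal.ofReal r⁻¹ := by
  have := lintegral_rpow_mul_exp (p := 1) one_pos hr
  simpa [Real.rpow_neg_one] using this

theorem lintegral_one_sub_cos_mul_exp {s : ℝ} (hs : 0 < s) :
    ∫⁻ x in Ioi (0 : ℝ), ENNReal.ofReal ((1 - Real.cos x) * Real.exp (-(x * s)))
      = ENNReal.ofReal (s⁻¹ * (1 + s ^ 2)⁻¹) := by
  -- An explicit antiderivative of `(1 - cos x) exp (-x s)` that vanishes at infinity.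
  set F : ℝ → ℝ := fun x =>
    Real.exp (-(x * s)) * (-s⁻¹ + (s * Real.cos x - Real.sin x) * (1 + s ^ 2)⁻¹) with hF
  have hs2 : (1 + s ^ 2) ≠ 0 := by positivity
  have hd : ∀ x, HasDerivAt F ((1 - Real.cos x) * Real.exp (-(x * s))) x := by
    intro x
    have h1 : HasDerivAt (fun x : ℝ => Real.exp (-(x * s))) (Real.exp (-(x * s)) * -(1 * s)) x :=
      (((hasDerivAt_id x).mul_const s).neg).exp
    have h2 : HasDerivAt (fun x : ℝ => -s⁻¹ + (s * Real.cos x - Real.sin x) * (1 + s ^ 2)⁻¹)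
        ((s * -Real.sin x - Real.cos x) * (1 + s ^ 2)⁻¹) x :=
      ((((Real.hasDerivAt_cos x).const_mul s).sub (Real.hasDerivAt_sin x)).mul_const _).const_add _
    refine (h1.mul h2).congr_deriv ?_
    field_simp
    ring
  have hl : Tendsto F atTop (𝓝 0) := by
    have h1 : Tendsto (fun x : ℝ => Real.exp (-(x * s))) atTop (𝓝 0) :=
      Real.tendsto_exp_neg_atTop_nhds_zero.comp (tendsto_id.atTop_mul_const hs)
    refine (h1.zero_mul_isBoundedUnder_le ?_)
    refine isBoundedUnder_of ⟨s⁻¹ + (s + 1) * (1 + s ^ 2)⁻¹, fun x => ?_⟩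
    simp only [Function.comp, Real.norm_eq_abs]
    have hc := Real.abs_cos_le_one x
    have hsn := Real.abs_sin_le_one x
    calc _ ≤ |-s⁻¹| + |(s * Real.cos x - Real.sin x) * (1 + s ^ 2)⁻¹| := abs_add_le _ _
      _ ≤ _ := by
        rw [abs_neg, abs_of_pos (inv_pos.2 hs), abs_mul, abs_of_pos (by positivity : 0 < (1 + s ^ 2)⁻¹)]
        gcongr
        calc _ ≤ |s * Real.cos x| + |Real.sin x| := abs_sub _ _
          _ ≤ s + 1 := by rw [abs_mul, abs_of_pos hs]; nlinarith
  have := (integrableOn_and_lintegral_Ioi_of_hasDerivAt (a := 0) (hd 0).continuousAt.continuousWithinAt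
    (fun x _ => hd x) (fun x _ => mul_nonneg (by linarith [Real.cos_le_one x]) (Real.exp_pos _).le) hl).2
  rw [this]
  congr 1
  simp [hF]
  field_simp
  ring

theorem ofReal_rpow_neg_eq_lintegral {p x : ℝ} (hp : 0 < p) (hx : 0 < x) :
    ENNReal.ofReal (x ^ (-p)) = ENNReal.ofReal (Real.Gamma p)⁻¹ *
      ∫⁻ s in Ioi (0 : ℝ), ENNReal.ofReal (s ^ (p - 1)) * ENNReal.ofReal (Real.exp (-(x * s))) := by
  have hpos : 0 < Real.Gamma p := Real.Gamma_pos_of_pos hp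
  have h : ∫⁻ s in Ioi (0 : ℝ), ENNReal.ofReal (s ^ (p - 1)) * ENNReal.ofReal (Real.exp (-(x * s)))
      = ENNReal.ofReal (Real.Gamma p * x ^ (-p)) := by
    rw [← lintegral_rpow_mul_exp hp hx]
    refine setLIntegral_congr_fun measurableSet_Ioi fun s hs => ?_
    exact (ENNReal.ofReal_mul (Real.rpow_nonneg (le_of_lt hs) _)).symm
  rw [h, ← ENNReal.ofReal_mul (by positivity), inv_mul_cancel_left₀ hpos.ne']

theorem lintegral_rpow_mul_exp_neg_mul_sq {p b : ℝ} (hp : 0 < p) (hb : 0 < b) :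
    ∫⁻ s in Ioi (0 : ℝ), ENNReal.ofReal (s ^ (p - 1) * Real.exp (-(b * s ^ 2)))
      = ENNReal.ofReal (b ^ (-(p / 2)) * (Real.Gamma (p / 2) / 2)) := by
  have h := integral_rpow_mul_exp_neg_mul_rpow (p := 2) (q := p - 1) (b := b) two_pos (by linarith) hb
  have hpos : 0 < Real.Gamma (p / 2) := Real.Gamma_pos_of_pos (by linarith)
  have e : b ^ (-(p - 1 + 1) / 2) * (1 / 2) * Real.Gamma ((p - 1 + 1) / 2)
      = b ^ (-(p / 2)) * (Real.Gamma (p / 2) / 2) := by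
    rw [sub_add_cancel, neg_div]; ring
  rw [e] at h
  simp only [neg_mul, Real.rpow_two] at h
  rw [← ofReal_integral_eq_lintegral_ofReal, h]
  · by_contra hc
    rw [integral_undef hc] at h
    have : 0 < b ^ (-(p / 2)) * (Real.Gamma (p / 2) / 2) := by positivity
    linarith
  · refine (ae_restrict_iff' measurableSet_Ioi).2 (ae_of_all _ fun x hx => ?_)
    have : 0 < x := hx
    positivity

/-- Write `1 / (1 + s²)` as `∫ exp (-v (1 + s²)) dv` and apply Tonelli; a Gaussian moment and then a
Gamma integral remain. -/
theorem lintegral_rpow_div_one_add_sq {p : ℝ} (hp : 0 < p) (hp2 : p < 2) :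
    ∫⁻ s in Ioi (0 : ℝ), ENNReal.ofReal (s ^ (p - 1) * (1 + s ^ 2)⁻¹)
      = ENNReal.ofReal (Real.Gamma (p / 2) * Real.Gamma (1 - p / 2) / 2) := by
  have hpos : 0 < Real.Gamma (p / 2) := Real.Gamma_pos_of_pos (by linarith)
  calc _ = ∫⁻ s in Ioi (0 : ℝ), ENNReal.ofReal (s ^ (p - 1)) *
        ∫⁻ v in Ioi (0 : ℝ), ENNReal.ofReal (Real.exp (-v)) * ENNReal.ofReal (Real.exp (-(v * s ^ 2))) := by
        refine setLIntegral_congr_fun measurableSet_Ioi fun s hs => ?_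
        rw [ENNReal.ofReal_mul (Real.rpow_nonneg (le_of_lt hs) _),
          ← lintegral_exp_neg_mul (by positivity : 0 < 1 + s ^ 2)]
        congr 2
        ext v
        rw [← ENNReal.ofReal_mul (Real.exp_pos _).le, ← Real.exp_add]
        congr 2; ring
    _ = ∫⁻ v in Ioi (0 : ℝ), ENNReal.ofReal (Real.exp (-v)) *
        ∫⁻ s in Ioi (0 : ℝ), ENNReal.ofReal (s ^ (p - 1)) * ENNReal.ofReal (Real.exp (-(v * s ^ 2))) :=
        lintegral_lintegral_mul_swap (by fun_prop) (by fun_prop) (by fun_prop)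
    _ = ∫⁻ v in Ioi (0 : ℝ), ENNReal.ofReal (Real.Gamma (p / 2) / 2) *
          ENNReal.ofReal (v ^ ((1 - p / 2) - 1) * Real.exp (-(1 * v))) := by
        refine setLIntegral_congr_fun measurableSet_Ioi fun v hv => ?_
        have hv' : 0 < v := hv
        have : ∫⁻ s in Ioi (0 : ℝ), ENNReal.ofReal (s ^ (p - 1)) * ENNReal.ofReal (Real.exp (-(v * s ^ 2)))
            = ENNReal.ofReal (v ^ (-(p / 2)) * (Real.Gamma (p / 2) / 2)) := by
          rw [← lintegral_rpow_mul_exp_neg_mul_sq hp hv']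
          refine setLIntegral_congr_fun measurableSet_Ioi fun s hs => ?_
          exact (ENNReal.ofReal_mul (Real.rpow_nonneg (le_of_lt hs) _)).symm
        rw [this, ← ENNReal.ofReal_mul (Real.exp_pos _).le, ← ENNReal.ofReal_mul (by positivity),
          one_mul, show 1 - p / 2 - 1 = -(p / 2) by ring]
        congr 1; ring
    _ = _ := by
        rw [lintegral_const_mul _ (by fun_prop), lintegral_rpow_mul_exp (by linarith) one_pos,
          Real.one_rpow, ← ENNReal.ofReal_mul (by positivity)]
        congr 1; ring

theorem tailConst_pos {α : ℝ} (h0 : 0 < α) (h2 : α < 2) : 0 < tailConst α := by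
  have := Real.Gamma_pos_of_pos h0
  have hs : 0 < Real.sin (Real.pi * α / 2) :=
    Real.sin_pos_of_pos_of_lt_pi (by positivity) (by nlinarith [Real.pi_pos])
  unfold tailConst
  positivity

/-- Write `x ^ (-(1 + α))` as a Gamma integral of `exp (-x s)` and apply Tonelli. The Laplace
transform of `1 - cos` is `1 / (s (1 + s²))`, and the reflection formula turns the remaining
integral into `π / (2 sin (π α / 2))`. This covers `α = 1` without a separate case. -/
theorem lintegral_one_sub_cos_mul_rpow {α : ℝ} (h0 : 0 < α) (h2 : α < 2) :
    ∫⁻ x in Ioi (0 : ℝ), ENNReal.ofReal ((1 - Real.cos x) * x ^ (-(1 + α)))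
      = ENNReal.ofReal (α * tailConst α)⁻¹ := by
  have hG : 0 < Real.Gamma (1 + α) := Real.Gamma_pos_of_pos (by linarith)
  have hc : ∀ x, 0 ≤ 1 - Real.cos x := fun x => by linarith [Real.cos_le_one x]
  calc _ = ∫⁻ x in Ioi (0 : ℝ), ENNReal.ofReal (Real.Gamma (1 + α))⁻¹ * (ENNReal.ofReal (1 - Real.cos x) *
        ∫⁻ s in Ioi (0 : ℝ), ENNReal.ofReal (s ^ (1 + α - 1)) * ENNReal.ofReal (Real.exp (-(x * s)))) := by
        refine setLIntegral_congr_fun measurableSet_Ioi fun x hx => ?_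
        rw [ENNReal.ofReal_mul (hc x), ofReal_rpow_neg_eq_lintegral (by linarith) hx, mul_left_comm]
    _ = ENNReal.ofReal (Real.Gamma (1 + α))⁻¹ * ∫⁻ s in Ioi (0 : ℝ), ENNReal.ofReal (s ^ (1 + α - 1)) *
          ∫⁻ x in Ioi (0 : ℝ), ENNReal.ofReal (1 - Real.cos x) * ENNReal.ofReal (Real.exp (-(x * s))) := by
        rw [lintegral_const_mul' _ _ ENNReal.ofReal_ne_top,
          lintegral_lintegral_mul_swap (by fun_prop) (by fun_prop) (by fun_prop)]
    _ = ENNReal.ofReal (Real.Gamma (1 + α))⁻¹ *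
          ∫⁻ s in Ioi (0 : ℝ), ENNReal.ofReal (s ^ (α - 1) * (1 + s ^ 2)⁻¹) := by
        congr 1
        refine setLIntegral_congr_fun measurableSet_Ioi fun s hs => ?_
        have hs' : 0 < s := hs
        simp_rw [← ENNReal.ofReal_mul (hc _)]
        rw [lintegral_one_sub_cos_mul_exp hs', ← ENNReal.ofReal_mul (by positivity)]
        congr 1
        rw [Real.rpow_sub hs', Real.rpow_sub hs', Real.rpow_add hs', Real.rpow_one]
        field_simp
    _ = _ := by
        rw [lintegral_rpow_div_one_add_sq h0 h2, Real.Gamma_mul_Gamma_one_sub,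
          ← ENNReal.ofReal_mul (by positivity)]
        congr 1
        rw [add_comm, Real.Gamma_add_one h0.ne', tailConst, show Real.pi * (α / 2) = Real.pi * α / 2 by ring]
        have := Real.Gamma_pos_of_pos h0
        have hs : 0 < Real.sin (Real.pi * α / 2) :=
          Real.sin_pos_of_pos_of_lt_pi (by positivity) (by nlinarith [Real.pi_pos])
        have := Real.pi_pos
        field_simp

/-- The Beta value `B(2α, 1 - α)`, again by representing `v ^ (-(1 + α))` as a Gamma integral; the
shift `v = x + 1` makes the inner integral a Gamma integral too. -/
theorem lintegral_Ioi_one_beta {α : ℝ} (h0 : 0 < α) (h1 : α < 1) :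
    ∫⁻ v in Ioi (1 : ℝ), ENNReal.ofReal (v ^ (-(1 + α)) * (v - 1) ^ (-α))
      = ENNReal.ofReal (Real.Gamma (2 * α) * Real.Gamma (1 - α) / Real.Gamma (1 + α)) := by
  have hG : 0 < Real.Gamma (1 + α) := Real.Gamma_pos_of_pos (by linarith)
  have hG1 : 0 < Real.Gamma (1 - α) := Real.Gamma_pos_of_pos (by linarith)
  have hsub : ∀ s : ℝ, 0 < s → ∫⁻ v in Ioi (1 : ℝ), ENNReal.ofReal ((v - 1) ^ (-α)) * ENNReal.ofReal (Real.exp (-(v * s)))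
      = ENNReal.ofReal (Real.exp (-s) * (Real.Gamma (1 - α) * s ^ (-(1 - α)))) := by
    intro s hs
    rw [ENNReal.ofReal_mul (Real.exp_pos _).le, ← lintegral_rpow_mul_exp (by linarith : 0 < 1 - α) hs,
      ← lintegral_const_mul' _ _ ENNReal.ofReal_ne_top,
      ← (measurePreserving_add_right volume (1 : ℝ)).setLIntegral_comp_preimage measurableSet_Ioi (by fun_prop)]
    simp only [preimage_add_const_Ioi, sub_self, add_sub_cancel_right]
    refine setLIntegral_congr_fun measurableSet_Ioi fun x hx => ?_
    rw [← ENNReal.ofReal_mul (Real.rpow_nonneg (le_of_lt hx) _), ← ENNReal.ofReal_mul (Real.exp_pos _).le,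
      show -((x + 1) * s) = -s + -(s * x) by ring, Real.exp_add, show 1 - α - 1 = -α by ring]
    congr 1; ring
  calc _ = ∫⁻ v in Ioi (1 : ℝ), ENNReal.ofReal (Real.Gamma (1 + α))⁻¹ * (ENNReal.ofReal ((v - 1) ^ (-α)) *
        ∫⁻ s in Ioi (0 : ℝ), ENNReal.ofReal (s ^ (1 + α - 1)) * ENNReal.ofReal (Real.exp (-(v * s)))) := by
        refine setLIntegral_congr_fun measurableSet_Ioi fun v hv => ?_
        have hv' : 1 < v := hv
        rw [ENNReal.ofReal_mul (by positivity), ofReal_rpow_neg_eq_lintegral (by linarith) (by linarith)]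
        ring
    _ = ENNReal.ofReal (Real.Gamma (1 + α))⁻¹ * ∫⁻ s in Ioi (0 : ℝ), ENNReal.ofReal (s ^ (1 + α - 1)) *
          ∫⁻ v in Ioi (1 : ℝ), ENNReal.ofReal ((v - 1) ^ (-α)) * ENNReal.ofReal (Real.exp (-(v * s))) := by
        rw [lintegral_const_mul' _ _ ENNReal.ofReal_ne_top,
          lintegral_lintegral_mul_swap (by fun_prop) (by fun_prop) (by fun_prop)]
    _ = ENNReal.ofReal (Real.Gamma (1 + α))⁻¹ * ∫⁻ s in Ioi (0 : ℝ), ENNReal.ofReal (Real.Gamma (1 - α)) *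
          ENNReal.ofReal (s ^ (2 * α - 1) * Real.exp (-(1 * s))) := by
        congr 1
        refine setLIntegral_congr_fun measurableSet_Ioi fun s hs => ?_
        have hs' : 0 < s := hs
        rw [hsub s hs', ← ENNReal.ofReal_mul (by positivity), ← ENNReal.ofReal_mul hG1.le,
          show 2 * α - 1 = (1 + α - 1) + (-(1 - α)) by ring, Real.rpow_add hs', one_mul]
        congr 1; ring
    _ = _ := by
        rw [lintegral_const_mul _ (by fun_prop), lintegral_rpow_mul_exp (by linarith) one_pos,
          Real.one_rpow, ← ENNReal.ofReal_mul (by positivity), ← ENNReal.ofReal_mul (by positivity)]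
        congr 1; field_simp

/-- On `(1, 2]` the integrand is at least a constant times `(v - 1)⁻¹`. This is the only source of
divergence of `L` on `E` when `α ≥ 1`. -/
theorem lintegral_Ioi_one_beta_eq_top {α : ℝ} (h1 : 1 ≤ α) :
    ∫⁻ v in Ioi (1 : ℝ), ENNReal.ofReal (v ^ (-(1 + α)) * (v - 1) ^ (-α)) = ⊤ := by
  have hni : ¬ IntegrableOn (fun v : ℝ => (v - 1)⁻¹) (Ioc 1 2) := by
    intro h
    have := (intervalIntegrable_iff_integrableOn_Ioc_of_le (by norm_num : (1:ℝ) ≤ 2)).2 h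
    rw [intervalIntegrable_sub_inv_iff] at this
    simp at this
  have htop : ∫⁻ v in Ioc (1 : ℝ) 2, ENNReal.ofReal ((v - 1)⁻¹) = ⊤ := by
    by_contra hc
    refine hni ⟨by fun_prop, ?_⟩
    rw [hasFiniteIntegral_iff_ofReal]
    · exact lt_top_iff_ne_top.2 hc
    · refine (ae_restrict_iff' measurableSet_Ioc).2 (ae_of_all _ fun x hx => ?_)
      exact inv_nonneg.2 (by linarith [hx.1])
  have hc : 0 < (2 : ℝ) ^ (-(1 + α)) := by positivity
  rw [eq_top_iff]
  calc (⊤ : ℝ≥0∞) = ENNReal.ofReal ((2 : ℝ) ^ (-(1 + α))) * ⊤ := by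
        rw [ENNReal.mul_top (by simpa using hc)]
    _ = ∫⁻ v in Ioc (1 : ℝ) 2, ENNReal.ofReal ((2 : ℝ) ^ (-(1 + α))) * ENNReal.ofReal ((v - 1)⁻¹) := by
        rw [lintegral_const_mul' _ _ ENNReal.ofReal_ne_top, htop]
    _ ≤ ∫⁻ v in Ioc (1 : ℝ) 2, ENNReal.ofReal (v ^ (-(1 + α)) * (v - 1) ^ (-α)) := by
        refine setLIntegral_mono' measurableSet_Ioc fun v hv => ?_
        have hv1 : 0 < v - 1 := by linarith [hv.1]
        rw [← ENNReal.ofReal_mul hc.le]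
        refine ENNReal.ofReal_le_ofReal (mul_le_mul ?_ ?_ (by positivity) (Real.rpow_nonneg (by linarith) _))
        · exact Real.rpow_le_rpow_of_nonpos (by linarith) hv.2 (by linarith)
        · rw [← Real.rpow_neg_one]
          exact Real.rpow_le_rpow_of_exponent_ge hv1 (by linarith [hv.2]) (by linarith)
    _ ≤ _ := lintegral_mono_set Ioc_subset_Ioi_self

end Integrals

/-! ### The weighted Lévy measure and its Fourier transform. -/

section Levy

open Set

theorem integrable_comp_abs {f : ℝ → ℝ} (hf : IntegrableOn f (Ioi 0)) :
    Integrable (fun x => f |x|) := by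
  have h1 : IntegrableOn (fun x => f |x|) (Ioi 0) :=
    hf.congr_fun (fun x hx => by simp only [abs_of_pos (mem_Ioi.1 hx)]) measurableSet_Ioi
  have h2 : IntegrableOn (fun x ↦ f |x|) (Iic 0) := by
    rw [← Measure.map_neg_eq_self (volume : Measure ℝ)]
    let m : MeasurableEmbedding fun x : ℝ => -x := (Homeomorph.neg ℝ).measurableEmbedding
    rw [m.integrableOn_map_iff]
    simp_rw [Function.comp_def, abs_neg, neg_preimage, neg_Iic, neg_zero]
    exact Iff.mpr integrableOn_Ici_iff_integrableOn_Ioi h1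
  rw [← integrableOn_univ, ← Iic_union_Ioi (a := (0 : ℝ))]
  exact h2.union h1

theorem integrableOn_and_integral_of_lintegral_ofReal {f : ℝ → ℝ} {s : Set ℝ} {c : ℝ} (hs : MeasurableSet s)
    (hf : Measurable f) (h0 : ∀ x ∈ s, 0 ≤ f x) (hc : 0 ≤ c)
    (h : ∫⁻ x in s, ENNReal.ofReal (f x) = ENNReal.ofReal c) :
    IntegrableOn f s ∧ ∫ x in s, f x = c := by
  have h0' : 0 ≤ᵐ[volume.restrict s] f := (ae_restrict_iff' hs).2 (ae_of_all _ h0)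
  refine ⟨⟨hf.aestronglyMeasurable, ?_⟩, ?_⟩
  · rw [hasFiniteIntegral_iff_ofReal h0', h]
    exact ENNReal.ofReal_lt_top
  · rw [integral_eq_lintegral_of_nonneg_ae h0' hf.aestronglyMeasurable, h, ENNReal.toReal_ofReal hc]

theorem integrableOn_and_integral_one_sub_cos_mul {α : ℝ} (h0 : 0 < α) (h2 : α < 2) {t : ℝ} (ht : 0 < t) :
    IntegrableOn (fun x : ℝ => (1 - Real.cos (t * x)) * x ^ (-(1 + α))) (Ioi 0) ∧
      ∫ x in Ioi (0 : ℝ), (1 - Real.cos (t * x)) * x ^ (-(1 + α)) = (α * tailConst α)⁻¹ * t ^ α := by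
  have hC := tailConst_pos h0 h2
  obtain ⟨hi, hv⟩ := integrableOn_and_integral_of_lintegral_ofReal measurableSet_Ioi
    (f := fun x : ℝ => (1 - Real.cos x) * x ^ (-(1 + α))) (by fun_prop)
    (fun x hx => mul_nonneg (by linarith [Real.cos_le_one x]) (Real.rpow_nonneg (le_of_lt hx) _))
    (by positivity) (lintegral_one_sub_cos_mul_rpow h0 h2)
  have he : EqOn (fun x : ℝ => (1 - Real.cos (t * x)) * x ^ (-(1 + α)))
      (fun x => t ^ (1 + α) * ((1 - Real.cos (t * x)) * (t * x) ^ (-(1 + α)))) (Ioi 0) := by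
    intro x hx
    simp only
    rw [Real.mul_rpow ht.le (le_of_lt hx), Real.rpow_neg ht.le]
    field_simp
  constructor
  · refine IntegrableOn.congr_fun (Integrable.const_mul ?_ _) he.symm measurableSet_Ioi
    exact (integrableOn_Ioi_comp_mul_left_iff
      (fun x : ℝ => (1 - Real.cos x) * x ^ (-(1 + α))) 0 ht).2 (by simpa using hi)
  · rw [setIntegral_congr_fun measurableSet_Ioi he, integral_const_mul,
      integral_comp_mul_left_Ioi (fun x : ℝ => (1 - Real.cos x) * x ^ (-(1 + α))) 0 ht, mul_zero, hv,
      Real.rpow_add ht, Real.rpow_one, smul_eq_mul]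
    field_simp

theorem integrable_and_integral_one_sub_cos {α : ℝ} (h0 : 0 < α) (h2 : α < 2) (t : ℝ) :
    Integrable (fun x : ℝ => (1 - Real.cos (t * x)) * |x| ^ (-(1 + α))) ∧
      ∫ x : ℝ, (1 - Real.cos (t * x)) * |x| ^ (-(1 + α)) = 2 * (α * tailConst α)⁻¹ * |t| ^ α := by
  rcases eq_or_ne t 0 with rfl | ht
  · simp [Real.zero_rpow h0.ne']
  obtain ⟨hi, hv⟩ := integrableOn_and_integral_one_sub_cos_mul h0 h2 (abs_pos.2 ht)
  have he : (fun x : ℝ => (1 - Real.cos (t * x)) * |x| ^ (-(1 + α)))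
      = fun x => (fun y => (1 - Real.cos (|t| * y)) * y ^ (-(1 + α))) |x| := by
    ext x
    simp only [← abs_mul, Real.cos_abs]
  rw [he]
  refine ⟨integrable_comp_abs hi, 
    (integral_comp_abs (f := fun y => (1 - Real.cos (|t| * y)) * y ^ (-(1 + α)))).trans ?_⟩
  rw [hv]; ring

/-- The density `α C_α |x| ^ (-(1 + α)) / 2` of the Lévy measure of `S_α`. -/
noncomputable def levyDensity (α x : ℝ) : ℝ := α * tailConst α / 2 * |x| ^ (-(1 + α))

/-- The weight `1 - exp (- x² / 2)`. -/
noncomputable def gaussWeight (x : ℝ) : ℝ := 1 - Real.exp (-(x ^ 2 / 2))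

theorem gaussWeight_nonneg (x : ℝ) : 0 ≤ gaussWeight x := by
  unfold gaussWeight
  have : Real.exp (-(x ^ 2 / 2)) ≤ 1 := Real.exp_le_one_iff.2 (by nlinarith [sq_nonneg x])
  linarith

theorem gaussWeight_le_one (x : ℝ) : gaussWeight x ≤ 1 := by
  unfold gaussWeight
  linarith [Real.exp_pos (-(x ^ 2 / 2))]

theorem continuous_gaussWeight : Continuous gaussWeight := by
  unfold gaussWeight
  fun_prop

theorem gaussWeight_pos {x : ℝ} (hx : x ≠ 0) : 0 < gaussWeight x := by
  unfold gaussWeight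
  have : Real.exp (-(x ^ 2 / 2)) < 1 := by
    rw [← Real.exp_zero, Real.exp_lt_exp]
    have := sq_pos_of_ne_zero hx
    linarith
  linarith

theorem levyDensity_nonneg {α : ℝ} (h0 : 0 < α) (h2 : α < 2) (x : ℝ) : 0 ≤ levyDensity α x := by
  have := tailConst_pos h0 h2
  unfold levyDensity
  positivity

@[fun_prop]
theorem measurable_levyDensity (α : ℝ) : Measurable (levyDensity α) := by
  unfold levyDensity
  fun_prop

theorem levyDensity_neg (α x : ℝ) : levyDensity α (-x) = levyDensity α x := by
  simp [levyDensity]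

theorem gaussWeight_neg (x : ℝ) : gaussWeight (-x) = gaussWeight x := by
  simp [gaussWeight]

theorem integral_cexp_gaussianReal (x : ℝ) :
    ∫ u, Complex.exp (u * x * Complex.I) ∂(gaussianReal 0 1) = Real.exp (-(x ^ 2 / 2)) := by
  have := charFun_gaussianReal (μ := 0) (v := 1) x
  rw [charFun_apply_real] at this
  simp_rw [mul_comm (x : ℂ)] at this
  rw [this]
  push_cast
  congr 1
  simp

theorem integrable_cos_gaussianReal (t x : ℝ) :
    Integrable (fun u => Real.cos ((t + u) * x)) (gaussianReal 0 1) :=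
  Integrable.of_bound (by fun_prop) 1 (ae_of_all _ fun u => Real.abs_cos_le_one _)

theorem integral_cos_gaussianReal (t x : ℝ) :
    ∫ u, Real.cos ((t + u) * x) ∂(gaussianReal 0 1) = Real.cos (t * x) * Real.exp (-(x ^ 2 / 2)) := by
  have h : ∫ u : ℝ, Complex.exp (((t + u) * x : ℝ) * Complex.I) ∂(gaussianReal 0 1)
      = Complex.exp ((t * x : ℝ) * Complex.I) * Real.exp (-(x ^ 2 / 2)) := by
    rw [← integral_cexp_gaussianReal, ← integral_const_mul]
    congr with u
    rw [← Complex.exp_add]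
    congr 1; push_cast; ring
  have h2 := congrArg Complex.re h
  rw [← RCLike.re_eq_complex_re, ← integral_re] at h2
  · simpa only [RCLike.re_eq_complex_re, Complex.exp_ofReal_mul_I_re, Complex.re_mul_ofReal] using h2
  · refine Integrable.of_bound (by fun_prop) 1 (ae_of_all _ fun u => ?_)
    rw [Complex.norm_exp_ofReal_mul_I]

theorem integrable_abs_rpow_gaussianReal {α : ℝ} (h0 : 0 < α) (h2 : α < 2) (t : ℝ) :
    Integrable (fun u : ℝ => |t + u| ^ α) (gaussianReal 0 1) := by
  have h : Integrable (fun u : ℝ => 1 + 2 * (t ^ 2 + u ^ 2)) (gaussianReal 0 1) := by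
    have := (memLp_id_gaussianReal (μ := 0) (v := 1) 2).integrable_sq
    exact (integrable_const _).add (((integrable_const _).add this).const_mul _)
  have hm : Measurable fun u : ℝ => |t + u| ^ α := by fun_prop
  refine h.mono' hm.aestronglyMeasurable (ae_of_all _ fun u => ?_)
  rw [Real.norm_of_nonneg (by positivity)]
  -- Because `α < 2`, a second Gaussian moment dominates.
  have hb : |t + u| ^ α ≤ 1 + |t + u| ^ 2 := by
    rcases le_total |t + u| 1 with h | h
    · have := Real.rpow_le_one (abs_nonneg (t + u)) h h0.le
      nlinarith [sq_nonneg |t + u|]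
    · have := Real.rpow_le_rpow_of_exponent_le h h2.le
      rw [Real.rpow_two] at this
      linarith
  rw [sq_abs] at hb
  nlinarith [sq_nonneg (t - u)]

/-- Integrate `∫ (1 - cos (t x)) levyDensity = |t| ^ α` with `t + u` in place of `t` against the
Gaussian law of `u`. By Fubini the factor becomes `1 - cos (t x) exp (-x² / 2)`, which is `1 - cos
(t x)` plus `cos (t x)` times the weight. -/
theorem integrable_and_integral_cos_mul_gaussWeight {α : ℝ} (h0 : 0 < α) (h2 : α < 2) (t : ℝ) :
    Integrable (fun x => Real.cos (t * x) * (gaussWeight x * levyDensity α x)) ∧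
      ∫ x, Real.cos (t * x) * (gaussWeight x * levyDensity α x)
        = (∫ u, |t + u| ^ α ∂(gaussianReal 0 1)) - |t| ^ α := by
  have hC := tailConst_pos h0 h2
  have key : ∀ t : ℝ, Integrable (fun x => (1 - Real.cos (t * x)) * levyDensity α x) ∧
      ∫ x, (1 - Real.cos (t * x)) * levyDensity α x = |t| ^ α := by
    intro t
    obtain ⟨hi, hv⟩ := integrable_and_integral_one_sub_cos h0 h2 t
    have he : (fun x => (1 - Real.cos (t * x)) * levyDensity α x) =
        fun x => α * tailConst α / 2 * ((1 - Real.cos (t * x)) * |x| ^ (-(1 + α))) := by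
      ext x; unfold levyDensity; ring
    rw [he]
    refine ⟨hi.const_mul _, ?_⟩
    rw [integral_const_mul, hv]
    field_simp
  have hint : Integrable (Function.uncurry fun x u : ℝ => (1 - Real.cos ((t + u) * x)) * levyDensity α x)
      (volume.prod (gaussianReal 0 1)) := by
    rw [integrable_prod_iff' (by
      have : Measurable (Function.uncurry fun x u : ℝ => (1 - Real.cos ((t + u) * x)) * levyDensity α x) := by
        fun_prop
      exact this.aestronglyMeasurable)]
    refine ⟨ae_of_all _ fun u => (key (t + u)).1, ?_⟩
    refine (integrable_abs_rpow_gaussianReal h0 h2 t).congr (ae_of_all _ fun u => ?_)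
    simp only [Function.uncurry]
    rw [← (key (t + u)).2]
    congr with x
    rw [Real.norm_of_nonneg]
    exact mul_nonneg (by linarith [Real.cos_le_one ((t + u) * x)]) (levyDensity_nonneg h0 h2 x)
  have hin : ∀ x, ∫ u, (1 - Real.cos ((t + u) * x)) * levyDensity α x ∂(gaussianReal 0 1)
      = (1 - Real.cos (t * x)) * levyDensity α x + Real.cos (t * x) * (gaussWeight x * levyDensity α x) := by
    intro x
    rw [integral_mul_const, integral_sub (integrable_const _) (integrable_cos_gaussianReal t x),
      integral_cos_gaussianReal]
    simp [gaussWeight]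
    ring
  have h1 := hint.integral_prod_left
  have h3 := integral_integral_swap hint
  simp only [Function.uncurry] at h1
  simp_rw [hin] at h1 h3
  have h4 : Integrable (fun x => Real.cos (t * x) * (gaussWeight x * levyDensity α x)) := by
    refine (h1.sub (key t).1).congr (ae_of_all _ fun x => ?_)
    simp
  refine ⟨h4, ?_⟩
  rw [integral_add (key t).1 h4, (key t).2] at h3
  simp_rw [(key _).2] at h3
  linarith

/-- The Lévy measure of `S_α` weighted by `1 - exp (- x² / 2)`. -/
noncomputable def weightedLevy (α : ℝ) : Measure ℝ :=
  volume.withDensity fun x => ENNReal.ofReal (gaussWeight x * levyDensity α x)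

theorem integrable_gaussWeight_mul_levyDensity {α : ℝ} (h0 : 0 < α) (h2 : α < 2) :
    Integrable (fun x => gaussWeight x * levyDensity α x) := by
  simpa using (integrable_and_integral_cos_mul_gaussWeight h0 h2 0).1

theorem integral_withDensity_ofReal {E : Type*} [NormedAddCommGroup E] [NormedSpace ℝ E]
    {X : Type*} [MeasurableSpace X] {μ : Measure X} {f : X → ℝ} (hf : Measurable f) (h0 : ∀ x, 0 ≤ f x)
    (g : X → E) :
    ∫ x, g x ∂(μ.withDensity fun x => ENNReal.ofReal (f x)) = ∫ x, f x • g x ∂μ := by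
  rw [integral_withDensity_eq_integral_toReal_smul (by fun_prop) (ae_of_all _ fun _ => ENNReal.ofReal_lt_top)]
  simp_rw [ENNReal.toReal_ofReal (h0 _)]

theorem isFiniteMeasure_weightedLevy {α : ℝ} (h0 : 0 < α) (h2 : α < 2) :
    IsFiniteMeasure (weightedLevy α) :=
  isFiniteMeasure_withDensity_ofReal (integrable_gaussWeight_mul_levyDensity h0 h2).2

theorem charFun_withDensity_of_even {f : ℝ → ℝ} (hf : Measurable f) (h0 : ∀ x, 0 ≤ f x)
    (heven : ∀ x, f (-x) = f x) (hi : Integrable f) (t : ℝ) :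
    charFun (volume.withDensity fun x => ENNReal.ofReal (f x)) t
      = ((∫ x, Real.cos (t * x) * f x : ℝ) : ℂ) := by
  rw [charFun_apply_real, integral_withDensity_ofReal hf h0]
  have hg : Integrable fun x : ℝ => f x • Complex.exp (t * x * Complex.I) := by
    refine hi.mono (by fun_prop) (ae_of_all _ fun x => ?_)
    rw [norm_smul, ← Complex.ofReal_mul, Complex.norm_exp_ofReal_mul_I, mul_one]
  -- Averaging the integrand over `x` and `-x` removes the sine part.
  have h1 : ∫ x : ℝ, f x • Complex.exp (t * x * Complex.I)
      = ∫ x : ℝ, f (-x) • Complex.exp (t * (-x : ℝ) * Complex.I) :=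
    (integral_neg_eq_self (fun x : ℝ => f x • Complex.exp (t * x * Complex.I)) volume).symm
  have h2 : ∫ x : ℝ, (f x • Complex.exp (t * x * Complex.I) + f (-x) • Complex.exp (t * (-x : ℝ) * Complex.I))
      = 2 * ((∫ x, Real.cos (t * x) * f x : ℝ) : ℂ) := by
    rw [← integral_complex_ofReal, ← integral_const_mul]
    congr with x
    rw [heven]
    simp only [Complex.real_smul, Complex.ofReal_mul, Complex.ofReal_cos, Complex.ofReal_neg, mul_neg, neg_mul]
    rw [Complex.cos, neg_mul]
    ring
  rw [integral_add hg hg.comp_neg, ← h1, ← two_mul] at h2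
  exact mul_left_cancel₀ two_ne_zero h2

theorem charFun_weightedLevy {α : ℝ} (h0 : 0 < α) (h2 : α < 2) (t : ℝ) :
    charFun (weightedLevy α) t = (((∫ u, |t + u| ^ α ∂(gaussianReal 0 1)) - |t| ^ α : ℝ) : ℂ) := by
  rw [weightedLevy, charFun_withDensity_of_even (f := fun x => gaussWeight x * levyDensity α x) (continuous_gaussWeight.measurable.mul (by fun_prop))
    (fun x => mul_nonneg (gaussWeight_nonneg x) (levyDensity_nonneg h0 h2 x))
    (fun x => by rw [gaussWeight_neg, levyDensity_neg]) (integrable_gaussWeight_mul_levyDensity h0 h2),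
    (integrable_and_integral_cos_mul_gaussWeight h0 h2 t).2]

theorem weightedLevy_ne_zero {α : ℝ} (h0 : 0 < α) (h2 : α < 2) : weightedLevy α ≠ 0 := by
  have hC := tailConst_pos h0 h2
  intro h
  rw [weightedLevy, withDensity_eq_zero_iff (by
    exact (continuous_gaussWeight.measurable.mul (by fun_prop)).ennreal_ofReal.aemeasurable)] at h
  have h3 : ∀ᵐ x : ℝ, x = 0 := by
    filter_upwards [h] with x hx
    by_contra hne
    simp only [Pi.zero_apply, ENNReal.ofReal_eq_zero] at hx
    have : 0 < gaussWeight x * levyDensity α x := by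
      have := gaussWeight_pos hne
      have := abs_pos.2 hne
      unfold levyDensity
      positivity
    linarith
  have h4 : (volume : Measure ℝ) {x : ℝ | ¬ x = 0} = 0 := h3
  have h5 : (volume : Measure ℝ) (Ioi 0) ≤ volume {x : ℝ | ¬ x = 0} :=
    measure_mono fun x hx => ne_of_gt hx
  rw [h4, Real.volume_Ioi] at h5
  simp at h5

/-- The transform at `0` is the mass, so the masses converge to a nonzero limit; after normalization
this is Lévy's continuity theorem for probability measures. -/
theorem MeasureTheory.FiniteMeasure.tendsto_of_tendsto_charFun {μ : ℕ → FiniteMeasure ℝ} {μ₀ : FiniteMeasure ℝ}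
    (hμ₀ : μ₀ ≠ 0)
    (h : ∀ t : ℝ, Tendsto (fun n => charFun (μ n : Measure ℝ) t) atTop (𝓝 (charFun (μ₀ : Measure ℝ) t))) :
    Tendsto μ atTop (𝓝 μ₀) := by
  have hmass' : Tendsto (fun n => ((μ n).mass : ℝ)) atTop (𝓝 (μ₀.mass : ℝ)) := by
    have := (Complex.continuous_re.tendsto _).comp (h 0)
    simp only [charFun_zero, Complex.ofReal_re, Function.comp_def] at this
    exact this
  have hmass : Tendsto (fun n => (μ n).mass) atTop (𝓝 μ₀.mass) := NNReal.tendsto_coe.1 hmass'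
  have hm0 : μ₀.mass ≠ 0 := μ₀.mass_nonzero_iff.2 hμ₀
  have hne : ∀ᶠ n in atTop, μ n ≠ 0 := by
    filter_upwards [hmass.eventually_ne hm0] with n hn
    exact (μ n).mass_nonzero_iff.1 hn
  refine FiniteMeasure.tendsto_of_tendsto_normalize_testAgainstNN_of_tendsto_mass ?_ hmass
  refine ProbabilityMeasure.tendsto_of_tendsto_charFun fun t => ?_
  have hn : ∀ ν : FiniteMeasure ℝ, ν ≠ 0 →
      charFun (ν.normalize : Measure ℝ) t = ((ν.mass : ℝ) : ℂ)⁻¹ * charFun (ν : Measure ℝ) t := by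
    intro ν hν
    rw [FiniteMeasure.toMeasure_normalize_eq_of_nonzero _ hν, charFun_apply, charFun_apply,
      integral_smul_nnreal_measure]
    simp [NNReal.smul_def]
  rw [hn μ₀ hμ₀]
  refine Tendsto.congr' (hne.mono fun n h => (hn _ h).symm) ?_
  refine Tendsto.mul ?_ (h t)
  refine Tendsto.inv₀ ?_ (by simpa using hm0)
  exact (Complex.continuous_ofReal.tendsto _).comp hmass'

end Levy

/-! ### Tail asymptotics of the stable law for all `0 < α < 2`. -/

section Tail

open Set

theorem integral_gaussWeight_smul_cexp (ν : Measure ℝ) [IsProbabilityMeasure ν] (t : ℝ) :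
    ∫ x, gaussWeight x • Complex.exp (t * x * Complex.I) ∂ν
      = charFun ν t - ∫ u, charFun ν (t + u) ∂(gaussianReal 0 1) := by
  have hb : ∀ s x : ℝ, ‖Complex.exp (s * x * Complex.I)‖ = 1 := fun s x => by
    rw [← Complex.ofReal_mul, Complex.norm_exp_ofReal_mul_I]
  have hint : Integrable (Function.uncurry fun x u : ℝ => Complex.exp ((t + u : ℝ) * x * Complex.I))
      (ν.prod (gaussianReal 0 1)) := by
    have hc : Continuous (Function.uncurry fun x u : ℝ => Complex.exp ((t + u : ℝ) * x * Complex.I)) := by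
      fun_prop
    exact Integrable.of_bound hc.aestronglyMeasurable 1 (ae_of_all _ fun p => (hb _ _).le)
  have h1 := integral_integral_swap hint
  have h2 : ∀ x : ℝ, ∫ u : ℝ, Complex.exp ((t + u : ℝ) * x * Complex.I) ∂(gaussianReal 0 1)
      = Real.exp (-(x ^ 2 / 2)) * Complex.exp (t * x * Complex.I) := by
    intro x
    rw [← integral_cexp_gaussianReal, ← integral_mul_const]
    congr with u
    rw [← Complex.exp_add]
    congr 1; push_cast; ring
  have hi : ∀ c : ℝ → ℝ, Continuous c → (∀ x, |c x| ≤ 1) →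
      Integrable (fun x : ℝ => (c x : ℂ) * Complex.exp (t * x * Complex.I)) ν := by
    intro c hc h1
    refine Integrable.of_bound (by fun_prop) 1 (ae_of_all _ fun x => ?_)
    rw [norm_mul, hb, mul_one, Complex.norm_real]
    exact h1 x
  simp_rw [h2] at h1
  simp_rw [charFun_apply_real]
  rw [← h1, ← integral_sub (by simpa using hi (fun _ => 1) continuous_const (by simp))
    (hi _ (by fun_prop) fun x => ?_)]
  · congr with x
    rw [Complex.real_smul, gaussWeight]
    push_cast
    ring
  · rw [abs_of_pos (Real.exp_pos _)]
    exact Real.exp_le_one_iff.2 (by nlinarith [sq_nonneg x])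

/-- Used with `c = h ^ α`: the upper bound `y` does not depend on `c` and serves as the dominating
function, and the lower bound, from `exp (-z) ≤ 1 / (1 + z)`, gives the limit `y` as `c → ∞`. -/
theorem one_sub_exp_bounds {y c : ℝ} (hy : 0 ≤ y) (hc : 0 < c) :
    0 ≤ c * (1 - Real.exp (-(y / c))) ∧ c * (1 - Real.exp (-(y / c))) ≤ y ∧
      y / (1 + y / c) ≤ c * (1 - Real.exp (-(y / c))) := by
  have hz : 0 ≤ y / c := by positivity
  have h1 := Real.add_one_le_exp (-(y / c))
  have h2 := Real.add_one_le_exp (y / c)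
  have h3 : Real.exp (-(y / c)) ≤ 1 := Real.exp_le_one_iff.2 (by linarith)
  refine ⟨mul_nonneg hc.le (by linarith), ?_, ?_⟩
  · calc c * (1 - Real.exp (-(y / c))) ≤ c * (y / c) := by gcongr; linarith
      _ = y := by field_simp
  · have h4 : Real.exp (-(y / c)) ≤ (1 + y / c)⁻¹ := by
      rw [Real.exp_neg]
      exact inv_anti₀ (by positivity) (by linarith)
    calc y / (1 + y / c) = c * (1 - (1 + y / c)⁻¹) := by field_simp; ring
      _ ≤ _ := by gcongr

theorem tendsto_mul_one_sub_exp {y : ℝ} (hy : 0 ≤ y) :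
    Tendsto (fun c : ℝ => c * (1 - Real.exp (-(y / c)))) atTop (𝓝 y) := by
  have h1 : Tendsto (fun c : ℝ => y / (1 + y / c)) atTop (𝓝 y) := by
    have : Tendsto (fun c : ℝ => y / (1 + y / c)) atTop (𝓝 (y / (1 + 0))) :=
      (tendsto_const_nhds (x := y)).div
        ((tendsto_const_nhds (x := (1 : ℝ))).add (tendsto_const_nhds.div_atTop tendsto_id)) (by norm_num)
    simpa using this
  refine tendsto_of_tendsto_of_tendsto_of_le_of_le' h1 tendsto_const_nhds ?_ ?_
  · filter_upwards [eventually_gt_atTop 0] with c hc using (one_sub_exp_bounds hy hc).2.2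
  · filter_upwards [eventually_gt_atTop 0] with c hc using (one_sub_exp_bounds hy hc).2.1

/-- Weak convergence of the rescaled weighted laws to `weightedLevy α`, obtained from pointwise
convergence of transforms. The weight removes the neighbourhood of `0` in which the rescaled laws
have unbounded mass. -/
theorem tendsto_integral_gaussWeight_mul {α : ℝ} (h0 : 0 < α) (h2 : α < 2) {μ : Measure ℝ}
    (hμ : IsStdStable α μ) (f : BoundedContinuousFunction ℝ ℝ) :
    Tendsto (fun h : ℝ => h ^ α * ∫ x, gaussWeight (h⁻¹ * x) * f (h⁻¹ * x) ∂μ) atTop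
      (𝓝 (∫ x, gaussWeight x * levyDensity α x * f x)) := by
  have := hμ.1
  have hfin : ∀ h : ℝ, IsFiniteMeasure ((μ.map fun x => h⁻¹ * x).withDensity
      fun x => ENNReal.ofReal (h ^ α * gaussWeight x)) := by
    intro h
    have := Measure.isProbabilityMeasure_map (μ := μ) (f := fun x => h⁻¹ * x) (by fun_prop)
    refine isFiniteMeasure_withDensity_ofReal (Integrable.of_bound (C := |h ^ α|) ?_ ?_).2
    · exact (continuous_gaussWeight.const_mul _).aestronglyMeasurable
    · refine ae_of_all _ fun x => ?_
      rw [Real.norm_eq_abs, abs_mul, abs_of_nonneg (gaussWeight_nonneg x)]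
      exact mul_le_of_le_one_right (abs_nonneg _) (gaussWeight_le_one x)
  have hfin0 := isFiniteMeasure_weightedLevy h0 h2
  set κ : ℝ → FiniteMeasure ℝ := fun h => ⟨_, hfin h⟩ with hκ
  set κ₀ : FiniteMeasure ℝ := ⟨_, hfin0⟩ with hκ₀
  have hchar : ∀ h : ℝ, 0 < h → ∀ t : ℝ, charFun (κ h : Measure ℝ) t
      = ((∫ u, h ^ α * (1 - Real.exp (-(|t + u| ^ α / h ^ α))) ∂(gaussianReal 0 1)
        - h ^ α * (1 - Real.exp (-(|t| ^ α / h ^ α))) : ℝ) : ℂ) := by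
    intro h hh t
    have := Measure.isProbabilityMeasure_map (μ := μ) (f := fun x => h⁻¹ * x) (by fun_prop)
    have hp : ∀ s : ℝ, charFun (μ.map fun x => h⁻¹ * x) s = (Real.exp (-(|s| ^ α / h ^ α)) : ℝ) := by
      intro s
      rw [charFun_map_mul, hμ.2, abs_mul, abs_of_pos (inv_pos.2 hh), Real.mul_rpow (by positivity) (abs_nonneg _),
        Real.inv_rpow hh.le]
      congr 3; field_simp
    change charFun ((μ.map fun x => h⁻¹ * x).withDensity fun x => ENNReal.ofReal (h ^ α * gaussWeight x)) t = _
    rw [charFun_apply_real, integral_withDensity_ofReal (continuous_gaussWeight.measurable.const_mul _)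
      (fun x => mul_nonneg (by positivity) (gaussWeight_nonneg x))]
    simp_rw [mul_smul]
    rw [integral_smul, integral_gaussWeight_smul_cexp]
    simp_rw [hp]
    rw [integral_complex_ofReal, integral_const_mul, integral_sub (integrable_const _)]
    · simp
      ring
    · refine Integrable.of_bound ?_ 1 (ae_of_all _ fun u => ?_)
      · have : Measurable fun u : ℝ => Real.exp (-(|t + u| ^ α / h ^ α)) := by fun_prop
        exact this.aestronglyMeasurable
      · rw [Real.norm_of_nonneg (Real.exp_pos _).le]
        exact Real.exp_le_one_iff.2 (by simp; positivity)
  have hne : κ₀ ≠ 0 := fun h => weightedLevy_ne_zero h0 h2 (congrArg Subtype.val h)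
  have hpow : Tendsto (fun h : ℝ => h ^ α) atTop atTop := tendsto_rpow_atTop h0
  have hlim : ∀ t : ℝ, Tendsto (fun h => charFun (κ h : Measure ℝ) t) atTop (𝓝 (charFun (κ₀ : Measure ℝ) t)) := by
    intro t
    change Tendsto _ _ (𝓝 (charFun (weightedLevy α) t))
    rw [charFun_weightedLevy h0 h2]
    refine Tendsto.congr' ((eventually_gt_atTop 0).mono fun h hh => (hchar h hh t).symm) ?_
    refine (Complex.continuous_ofReal.tendsto _).comp (Tendsto.sub ?_ ?_)
    · refine tendsto_integral_filter_of_dominated_convergence (fun u => |t + u| ^ α) ?_ ?_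
        (integrable_abs_rpow_gaussianReal h0 h2 t) ?_
      · refine Eventually.of_forall fun h => ?_
        have : Measurable fun u : ℝ => h ^ α * (1 - Real.exp (-(|t + u| ^ α / h ^ α))) := by fun_prop
        exact this.aestronglyMeasurable
      · filter_upwards [eventually_gt_atTop 0] with h hh
        refine ae_of_all _ fun u => ?_
        obtain ⟨ha, hb, -⟩ := one_sub_exp_bounds (by positivity : 0 ≤ |t + u| ^ α) (by positivity : 0 < h ^ α)
        rwa [Real.norm_of_nonneg ha]
      · exact ae_of_all _ fun u => (tendsto_mul_one_sub_exp (by positivity)).comp hpow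
    · exact (tendsto_mul_one_sub_exp (by positivity)).comp hpow
  have hweak : Tendsto (fun h => ∫ x, f x ∂(κ h : Measure ℝ)) atTop (𝓝 (∫ x, f x ∂(κ₀ : Measure ℝ))) := by
    -- The continuity theorem above is sequential, so the limit in real `h` is tested along
    -- sequences.
    refine tendsto_of_seq_tendsto fun u hu => ?_
    exact FiniteMeasure.tendsto_iff_forall_integral_tendsto.1
      (FiniteMeasure.tendsto_of_tendsto_charFun hne fun t => (hlim t).comp hu) f
  have e0 : ∫ x, f x ∂(κ₀ : Measure ℝ) = ∫ x, gaussWeight x * levyDensity α x * f x := by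
    change ∫ x, f x ∂(weightedLevy α) = _
    rw [weightedLevy, integral_withDensity_ofReal
      (f := fun x => gaussWeight x * levyDensity α x)
      (continuous_gaussWeight.measurable.mul (by fun_prop))
      (fun x => mul_nonneg (gaussWeight_nonneg x) (levyDensity_nonneg h0 h2 x))]
    simp_rw [smul_eq_mul]
  rw [← e0]
  refine hweak.congr' ((eventually_gt_atTop 0).mono fun h hh => ?_)
  change ∫ x, f x ∂((μ.map fun x => h⁻¹ * x).withDensity fun x => ENNReal.ofReal (h ^ α * gaussWeight x)) = _
  rw [integral_withDensity_ofReal (continuous_gaussWeight.measurable.const_mul _)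
      (fun x => mul_nonneg (by positivity) (gaussWeight_nonneg x)),
    integral_map (by fun_prop) (by
      exact ((continuous_gaussWeight.const_mul _).smul f.continuous).aestronglyMeasurable)]
  simp_rw [smul_eq_mul, mul_assoc]
  exact integral_const_mul _ _

/-- The piecewise linear function which is `0` on `(-∞, 1]` and `1` on `[1 + ε, ∞)`. -/
noncomputable def ramp (ε x : ℝ) : ℝ := min 1 (max 0 ((x - 1) / ε))

theorem ramp_nonneg (ε x : ℝ) : 0 ≤ ramp ε x := le_min zero_le_one (le_max_left _ _)

theorem ramp_le_one (ε x : ℝ) : ramp ε x ≤ 1 := min_le_left _ _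

theorem ramp_eq_zero {ε x : ℝ} (hε : 0 < ε) (hx : x ≤ 1) : ramp ε x = 0 := by
  have : (x - 1) / ε ≤ 0 := div_nonpos_of_nonpos_of_nonneg (by linarith) hε.le
  simp [ramp, this]

theorem ramp_eq_one {ε x : ℝ} (hε : 0 < ε) (hx : 1 + ε ≤ x) : ramp ε x = 1 := by
  have : 1 ≤ (x - 1) / ε := by rw [le_div_iff₀ hε]; linarith
  simp [ramp, this]

theorem continuous_ramp (ε : ℝ) : Continuous (ramp ε) := by
  unfold ramp
  fun_prop

theorem integrable_indicator_levyDensity {α : ℝ} (h0 : 0 < α) {c : ℝ} (hc : 0 < c) :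
    IntegrableOn (levyDensity α) (Ioi c) ∧ ∫ x in Ioi c, levyDensity α x = tailConst α / 2 * c ^ (-α) := by
  have he : EqOn (fun x => α * tailConst α / 2 * x ^ (-(1 + α))) (levyDensity α) (Ioi c) := by
    intro x hx
    simp only [levyDensity, abs_of_pos (hc.trans hx)]
  constructor
  · exact IntegrableOn.congr_fun (Integrable.const_mul (integrableOn_Ioi_rpow_of_lt (by linarith) hc) _) he
      measurableSet_Ioi
  · rw [← setIntegral_congr_fun measurableSet_Ioi he, integral_const_mul, integral_Ioi_rpow_of_lt (by linarith) hc,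
      show -(1 + α) + 1 = -α by ring]
    field_simp

theorem tendsto_integral_ramp {α : ℝ} (h0 : 0 < α) (h2 : α < 2) {μ : Measure ℝ}
    (hμ : IsStdStable α μ) {ε : ℝ} (hε : 0 < ε) :
    Tendsto (fun h : ℝ => h ^ α * ∫ x, ramp ε (h⁻¹ * x) ∂μ) atTop
      (𝓝 (∫ x in Ioi 1, levyDensity α x * ramp ε x)) := by
  set m : ℝ := gaussWeight 1
  have hm : 0 < m := gaussWeight_pos one_ne_zero
  have hle : ∀ x, m ≤ gaussWeight (max x 1) := by
    intro x
    have : (1 : ℝ) ≤ max x 1 := le_max_right _ _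
    simp only [m, gaussWeight]
    gcongr
  -- The weight has to be divided out. Replacing `x` by `max x 1` keeps the denominator at least
  -- `gaussWeight 1`, and changes nothing where the ramp is nonzero.
  have hcont : Continuous fun x => ramp ε x / gaussWeight (max x 1) :=
    (continuous_ramp ε).div (continuous_gaussWeight.comp (by fun_prop)) fun x => (hm.trans_le (hle x)).ne'
  set F : BoundedContinuousFunction ℝ ℝ := BoundedContinuousFunction.ofNormedAddCommGroup
    (fun x => ramp ε x / gaussWeight (max x 1)) hcont m⁻¹ (fun x => by
      rw [Real.norm_of_nonneg (div_nonneg (ramp_nonneg _ _) (gaussWeight_nonneg _)), div_eq_mul_inv]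
      calc _ ≤ 1 * m⁻¹ := by
            have := ramp_le_one ε x
            have := inv_anti₀ hm (hle x)
            have := inv_nonneg.2 (gaussWeight_nonneg (max x 1))
            gcongr
        _ = m⁻¹ := one_mul _)
  have hF : ∀ x, gaussWeight x * F x = ramp ε x := by
    intro x
    change gaussWeight x * (ramp ε x / gaussWeight (max x 1)) = _
    rcases le_total x 1 with hx | hx
    · rw [ramp_eq_zero hε hx]; simp
    · rw [max_eq_left hx, mul_div_cancel₀]
      exact (gaussWeight_pos (by linarith)).ne'
  have h := tendsto_integral_gaussWeight_mul h0 h2 hμ F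
  simp_rw [hF] at h
  convert h using 2
  rw [← integral_indicator measurableSet_Ioi]
  congr with x
  rw [mul_right_comm, hF, mul_comm]
  by_cases hx : x ∈ Ioi (1 : ℝ)
  · rw [indicator_of_mem hx]
  · rw [indicator_of_notMem hx, ramp_eq_zero hε (not_lt.1 hx), mul_zero]

/-- The ramp lies between the indicators of `[1 + ε, ∞)` and `[1, ∞)`. Its limiting integral differs
from `C_α / 2` by at most a factor `(1 + ε) ^ (-α)`, and `ε` is chosen after the target bound. -/
theorem tendsto_rpow_mul_measureReal_Ici {α : ℝ} (h0 : 0 < α) (h2 : α < 2) {μ : Measure ℝ}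
    (hμ : IsStdStable α μ) :
    Tendsto (fun h : ℝ => h ^ α * μ.real (Ici h)) atTop (𝓝 (tailConst α / 2)) := by
  have := hμ.1
  have hC := tailConst_pos h0 h2
  have hind : ∀ h : ℝ, μ.real (Ici h) = ∫ x, (Ici h).indicator (fun _ => (1 : ℝ)) x ∂μ := fun h => by
    exact (integral_indicator_one measurableSet_Ici).symm
  have hri : ∀ ε h : ℝ, Integrable (fun x => ramp ε (h⁻¹ * x)) μ := fun ε h =>
    Integrable.of_bound ((continuous_ramp ε).comp (by fun_prop)).aestronglyMeasurable 1
      (ae_of_all _ fun x => by rw [Real.norm_of_nonneg (ramp_nonneg _ _)]; exact ramp_le_one _ _)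
  have hii : ∀ h : ℝ, Integrable ((Ici h).indicator (fun _ => (1 : ℝ))) μ := fun h =>
    (integrable_const _).indicator measurableSet_Ici
  have hup : ∀ ε h : ℝ, 0 < ε → 0 < h → ∫ x, ramp ε (h⁻¹ * x) ∂μ ≤ μ.real (Ici h) := by
    intro ε h hε hh
    rw [hind]
    refine integral_mono (hri _ _) (hii _) fun x => ?_
    by_cases hx : x ∈ Ici h
    · simp only [indicator_of_mem hx]; exact ramp_le_one _ _
    · simp only [indicator_of_notMem hx]
      refine (ramp_eq_zero hε ?_).le
      rw [inv_mul_le_iff₀ hh]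
      simpa using (lt_of_not_ge hx).le
  have hlow : ∀ ε h : ℝ, 0 < ε → 0 < h → μ.real (Ici ((1 + ε) * h)) ≤ ∫ x, ramp ε (h⁻¹ * x) ∂μ := by
    intro ε h hε hh
    rw [hind]
    refine integral_mono (hii _) (hri _ _) fun x => ?_
    by_cases hx : x ∈ Ici ((1 + ε) * h)
    · simp only [indicator_of_mem hx]
      refine (ramp_eq_one hε ?_).ge
      rw [le_inv_mul_iff₀ hh, mul_comm]
      exact hx
    · simp only [indicator_of_notMem hx]
      exact ramp_nonneg _ _
  have hI : ∀ ε : ℝ, 0 < ε → tailConst α / 2 * (1 + ε) ^ (-α) ≤ ∫ x in Ioi 1, levyDensity α x * ramp ε x ∧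
      ∫ x in Ioi 1, levyDensity α x * ramp ε x ≤ tailConst α / 2 := by
    intro ε hε
    have hi1 := (integrable_indicator_levyDensity h0 one_pos).1
    have hi : IntegrableOn (fun x => levyDensity α x * ramp ε x) (Ioi 1) := by
      refine Integrable.mono' hi1 ((measurable_levyDensity α).mul (continuous_ramp ε).measurable).aestronglyMeasurable
        (ae_of_all _ fun x => ?_)
      rw [norm_mul, Real.norm_of_nonneg (levyDensity_nonneg h0 h2 x), Real.norm_of_nonneg (ramp_nonneg _ _)]
      exact mul_le_of_le_one_right (levyDensity_nonneg h0 h2 x) (ramp_le_one _ _)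
    constructor
    · rw [← (integrable_indicator_levyDensity h0 (by linarith : 0 < 1 + ε)).2]
      have hs : Ioi (1 + ε) ⊆ Ioi (1 : ℝ) := Ioi_subset_Ioi (by linarith)
      calc ∫ x in Ioi (1 + ε), levyDensity α x = ∫ x in Ioi (1 + ε), levyDensity α x * ramp ε x := by
            refine setIntegral_congr_fun measurableSet_Ioi fun x hx => ?_
            rw [ramp_eq_one hε (le_of_lt hx), mul_one]
        _ ≤ _ := setIntegral_mono_set hi
            (ae_of_all _ fun x => mul_nonneg (levyDensity_nonneg h0 h2 x) (ramp_nonneg _ _)) hs.eventuallyLE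
    · have := (integrable_indicator_levyDensity (α := α) h0 one_pos).2
      rw [Real.one_rpow, mul_one] at this
      rw [← this]
      exact setIntegral_mono hi hi1 fun x => mul_le_of_le_one_right (levyDensity_nonneg h0 h2 x) (ramp_le_one _ _)
  have hcont : ∀ b : ℝ, Tendsto (fun ε : ℝ => b * (1 + ε) ^ (-α)) (𝓝[>] 0) (𝓝 b) := by
    intro b
    have : ContinuousAt (fun ε : ℝ => b * (1 + ε) ^ (-α)) 0 :=
      continuousAt_const.mul ((continuousAt_const.add continuousAt_id).rpow_const (Or.inl (by norm_num)))
    have h := this.tendsto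
    simp only [add_zero, Real.one_rpow, mul_one] at h
    exact h.mono_left nhdsWithin_le_nhds
  refine tendsto_order.2 ⟨fun a ha => ?_, fun b hb => ?_⟩
  · obtain ⟨ε, hε1, hε⟩ := (((hcont (tailConst α / 2)).eventually (lt_mem_nhds ha)).and
      self_mem_nhdsWithin).exists
    filter_upwards [(tendsto_integral_ramp h0 h2 hμ hε).eventually (lt_mem_nhds (hε1.trans_le (hI ε hε).1)),
      eventually_gt_atTop 0] with h h3 hh
    refine h3.trans_le ?_
    have := hup ε h hε hh
    gcongr
  · obtain ⟨ε, hε1, hε⟩ := (((hcont b).eventually (lt_mem_nhds hb)).and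
      self_mem_nhdsWithin).exists
    have hε' : (0 : ℝ) < 1 + ε := by have : 0 < ε := hε; linarith
    have ht : Tendsto (fun h : ℝ => (1 + ε)⁻¹ * h) atTop atTop := tendsto_id.const_mul_atTop (by positivity)
    filter_upwards [ht.eventually ((tendsto_integral_ramp h0 h2 hμ hε).eventually
      (gt_mem_nhds ((hI ε hε).2.trans_lt hε1))), eventually_gt_atTop 0] with h h3 hh
    -- Applied at `h / (1 + ε)`, so that the larger threshold becomes `h` itself.
    have h4 := hlow ε ((1 + ε)⁻¹ * h) hε (by positivity)
    rw [mul_inv_cancel_left₀ hε'.ne'] at h4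
    have h5 : ((1 + ε)⁻¹ * h) ^ α * μ.real (Ici h) < b * (1 + ε) ^ (-α) :=
      lt_of_le_of_lt (by gcongr) h3
    rw [Real.mul_rpow (by positivity) hh.le, Real.inv_rpow hε'.le, Real.rpow_neg hε'.le, mul_assoc, mul_comm b] at h5
    exact lt_of_mul_lt_mul_left h5 (by positivity)

end Tail

/-! ### Density of the stable law for `α < 1` by Pólya's construction. -/

section Density

open Set

/-- The second derivative of `s ↦ exp (- s ^ α)` on `(0, ∞)`. -/
noncomputable def polyaWeight (α s : ℝ) : ℝ :=
  (α * (1 - α) * s ^ (α - 2) + α ^ 2 * s ^ (2 * α - 2)) * Real.exp (-s ^ α)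

@[fun_prop]
theorem measurable_polyaWeight (α : ℝ) : Measurable (polyaWeight α) := by
  unfold polyaWeight
  fun_prop

theorem polyaWeight_nonneg {α s : ℝ} (h0 : 0 < α) (h1 : α < 1) (hs : 0 ≤ s) : 0 ≤ polyaWeight α s := by
  have : 0 < 1 - α := by linarith
  unfold polyaWeight
  positivity

/-- Both `exp (-z)` and `z exp (-z)` are at most `1` for `z = s ^ α`, and the coefficients add up to
`α (1 - α) + α² = α`. The bound is homogeneous in `s`, hence uniform under the rescaling used later.
-/
theorem polyaWeight_le {α s : ℝ} (h0 : 0 < α) (h1 : α < 1) (hs : 0 < s) :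
    polyaWeight α s ≤ α * s ^ (α - 2) := by
  have e : s ^ (2 * α - 2) = s ^ (α - 2) * s ^ α := by rw [← Real.rpow_add hs]; ring_nf
  have h2 : Real.exp (-s ^ α) ≤ 1 := Real.exp_le_one_iff.2 (by simp; positivity)
  have h3 : s ^ α * Real.exp (-s ^ α) ≤ 1 := by
    rw [Real.exp_neg, ← div_eq_mul_inv, div_le_one (Real.exp_pos _)]
    linarith [Real.add_one_le_exp (s ^ α)]
  have h4 : 0 < s ^ (α - 2) := by positivity
  calc polyaWeight α s = s ^ (α - 2) * (α * (1 - α) * Real.exp (-s ^ α) + α ^ 2 * (s ^ α * Real.exp (-s ^ α))) := by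
        rw [polyaWeight, e]; ring
    _ ≤ s ^ (α - 2) * (α * (1 - α) * 1 + α ^ 2 * 1) := by
        have : 0 < 1 - α := by linarith
        gcongr
    _ = _ := by ring

/-- Taylor's formula from infinity for the convex function `φ(s) = exp (-s ^ α)`: integrate `φ''(s)
(s - t)` by parts. -/
theorem polya_representation {α t : ℝ} (h0 : 0 < α) (h1 : α < 1) (ht : 0 ≤ t) :
    IntegrableOn (fun s => polyaWeight α s * (s - t)) (Ioi t) ∧
      ∫ s in Ioi t, polyaWeight α s * (s - t) = Real.exp (-t ^ α) := by
  -- The antiderivative `φ'(s) (s - t) - φ(s)` of `φ''(s) (s - t)`. At `t = 0` the singular term has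
  -- coefficient `0`, so continuity at the left end survives.
  set F : ℝ → ℝ := fun s => -α * (s ^ α - t * s ^ (α - 1)) * Real.exp (-s ^ α) - Real.exp (-s ^ α) with hF
  have hd : ∀ s, 0 < s → HasDerivAt F (polyaWeight α s * (s - t)) s := by
    intro s hs
    have e1 : HasDerivAt (fun s : ℝ => s ^ α) (α * s ^ (α - 1)) s :=
      Real.hasDerivAt_rpow_const (Or.inl hs.ne')
    have e2 : HasDerivAt (fun s : ℝ => s ^ (α - 1)) ((α - 1) * s ^ (α - 1 - 1)) s :=
      Real.hasDerivAt_rpow_const (Or.inl hs.ne')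
    have e3 := e1.neg.exp
    refine ((((e1.sub (e2.const_mul t)).const_mul (-α)).mul e3).sub e3).congr_deriv ?_
    simp only [Pi.neg_apply, Pi.sub_apply]
    have a0 : s ^ (2 * α - 2) = s ^ α * s ^ α / s ^ 2 := by
      rw [← Real.rpow_add hs, ← Real.rpow_natCast, ← Real.rpow_sub hs]; push_cast; ring_nf
    have a1 : s ^ (α - 2) = s ^ α / s ^ 2 := by
      rw [← Real.rpow_natCast, ← Real.rpow_sub hs]; norm_num
    have a2 : s ^ (α - 1 - 1) = s ^ α / s ^ 2 := by rw [← a1]; ring_nf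
    have a3 : s ^ (α - 1) = s ^ α / s := by rw [Real.rpow_sub_one hs.ne']
    rw [polyaWeight, a0, a1, a2, a3]
    field_simp
    ring
  have hc : ContinuousWithinAt F (Ici t) t := by
    rcases ht.eq_or_lt with rfl | ht'
    · simp only [hF, zero_mul, sub_zero]
      have : Continuous fun s : ℝ => s ^ α := Real.continuous_rpow_const h0.le
      exact (by fun_prop : Continuous fun s : ℝ => -α * s ^ α * Real.exp (-s ^ α) - Real.exp (-s ^ α)).continuousWithinAt
    · exact (hd t ht').continuousAt.continuousWithinAt
  have hpow : Tendsto (fun s : ℝ => s ^ α) atTop atTop := tendsto_rpow_atTop h0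
  have hl : Tendsto F atTop (𝓝 0) := by
    have l1 : Tendsto (fun s : ℝ => Real.exp (-s ^ α)) atTop (𝓝 0) :=
      Real.tendsto_exp_neg_atTop_nhds_zero.comp hpow
    have l2 : Tendsto (fun s : ℝ => s ^ α * Real.exp (-s ^ α)) atTop (𝓝 0) := by
      simpa [Function.comp_def] using (Real.tendsto_pow_mul_exp_neg_atTop_nhds_zero 1).comp hpow
    have l3 : Tendsto (fun s : ℝ => s ^ (α - 1)) atTop (𝓝 0) := by
      have := tendsto_rpow_neg_atTop (y := 1 - α) (by linarith)
      simpa using this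
    have := ((l2.const_mul (-α)).add ((l3.mul l1).const_mul (α * t))).sub l1
    simp only [mul_zero, add_zero, sub_zero] at this
    refine this.congr fun s => ?_
    simp only [hF]
    ring
  have hn : ∀ s ∈ Ioi t, 0 ≤ polyaWeight α s * (s - t) := fun s hs =>
    mul_nonneg (polyaWeight_nonneg h0 h1 (ht.trans (le_of_lt hs))) (sub_nonneg.2 (le_of_lt hs))
  refine ⟨integrableOn_Ioi_deriv_of_nonneg hc (fun s hs => hd s (ht.trans_lt hs)) hn hl, ?_⟩
  rw [integral_Ioi_of_hasDerivAt_of_nonneg hc (fun s hs => hd s (ht.trans_lt hs)) hn hl]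
  have : t ^ α - t * t ^ (α - 1) = 0 := by
    rcases ht.eq_or_lt with rfl | ht'
    · simp [Real.zero_rpow h0.ne']
    · rw [Real.rpow_sub_one ht'.ne']; field_simp; simp
  simp only [hF, this]
  ring

theorem tailConst_one : tailConst 1 = 2 / Real.pi := by
  simp [tailConst]

/-- The density of `S_α` for `α < 1`, as a mixture of Fejér kernels. -/
noncomputable def stableDensity (α x : ℝ) : ℝ :=
  ∫ s in Ioi (0 : ℝ), (1 - Real.cos (s * x)) * |x| ^ (-(1 + 1) : ℝ) * (Real.pi⁻¹ * polyaWeight α s)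

theorem measurable_stableDensity (α : ℝ) : Measurable (stableDensity α) := by
  unfold stableDensity
  have : Measurable (Function.uncurry fun x s : ℝ =>
    (1 - Real.cos (s * x)) * |x| ^ (-(1 + 1) : ℝ) * (Real.pi⁻¹ * polyaWeight α s)) := by fun_prop
  exact this.stronglyMeasurable.integral_prod_right.measurable

theorem stableDensity_neg (α x : ℝ) : stableDensity α (-x) = stableDensity α x := by
  simp [stableDensity]

theorem stableDensity_nonneg {α : ℝ} (h0 : 0 < α) (h1 : α < 1) (x : ℝ) : 0 ≤ stableDensity α x := by
  refine setIntegral_nonneg measurableSet_Ioi fun s hs => ?_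
  have := polyaWeight_nonneg h0 h1 (le_of_lt hs)
  have : 0 ≤ 1 - Real.cos (s * x) := by linarith [Real.cos_le_one (s * x)]
  have := Real.pi_pos
  positivity

/-- The product formula writes `cos (t x) (1 - cos (s x))` through `1 - cos` at the frequencies `t +
s`, `t - s` and `t`; each is integrated by the `α = 1` case of the formula for `|t| ^ α`, where `C_1
= 2 / π`. -/
theorem integrable_and_integral_fejer (t s : ℝ) (hs : 0 < s) :
    Integrable (fun x => Real.cos (t * x) * ((1 - Real.cos (s * x)) * |x| ^ (-(1 + 1) : ℝ))) ∧
      ∫ x, Real.cos (t * x) * ((1 - Real.cos (s * x)) * |x| ^ (-(1 + 1) : ℝ)) = Real.pi * max (s - |t|) 0 := by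
  have key : ∀ t : ℝ, Integrable (fun x => (1 - Real.cos (t * x)) * |x| ^ (-(1 + 1) : ℝ)) ∧
      ∫ x, (1 - Real.cos (t * x)) * |x| ^ (-(1 + 1) : ℝ) = Real.pi * |t| := by
    intro t
    obtain ⟨hi, hv⟩ := integrable_and_integral_one_sub_cos one_pos one_lt_two t
    refine ⟨hi, hv.trans ?_⟩
    rw [tailConst_one, Real.rpow_one]
    field_simp
  obtain ⟨ia, va⟩ := key (t + s)
  obtain ⟨ib, vb⟩ := key (t - s)
  obtain ⟨ic, vc⟩ := key t
  have he : (fun x => Real.cos (t * x) * ((1 - Real.cos (s * x)) * |x| ^ (-(1 + 1) : ℝ)))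
      = fun x => (2⁻¹ * ((1 - Real.cos ((t + s) * x)) * |x| ^ (-(1 + 1) : ℝ))
        + 2⁻¹ * ((1 - Real.cos ((t - s) * x)) * |x| ^ (-(1 + 1) : ℝ)))
        - (1 - Real.cos (t * x)) * |x| ^ (-(1 + 1) : ℝ) := by
    ext x
    rw [add_mul, sub_mul t, Real.cos_add, Real.cos_sub]
    ring
  rw [he]
  have iab : Integrable fun x => 2⁻¹ * ((1 - Real.cos ((t + s) * x)) * |x| ^ (-(1 + 1) : ℝ))
      + 2⁻¹ * ((1 - Real.cos ((t - s) * x)) * |x| ^ (-(1 + 1) : ℝ)) :=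
    (ia.const_mul 2⁻¹).add (ib.const_mul 2⁻¹)
  refine ⟨iab.sub ic, ?_⟩
  rw [integral_sub iab ic, integral_add (ia.const_mul 2⁻¹) (ib.const_mul 2⁻¹), integral_const_mul,
    integral_const_mul, va, vb, vc]
  have : 2⁻¹ * |t + s| + 2⁻¹ * |t - s| - |t| = max (s - |t|) 0 := by
    grind
  rw [← this]
  ring

/-- At `t = 0` the integrand is nonnegative and its integral over `x` is `s` times the Pólya weight,
integrable by `polya_representation` at `0`. Other `t` are dominated by this case. -/
theorem integrable_fejer_mul_polyaWeight {α : ℝ} (h0 : 0 < α) (h1 : α < 1) (t : ℝ) :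
    Integrable (Function.uncurry fun x s : ℝ => Real.cos (t * x) *
      ((1 - Real.cos (s * x)) * |x| ^ (-(1 + 1) : ℝ) * (Real.pi⁻¹ * polyaWeight α s)))
      (volume.prod (volume.restrict (Ioi 0))) := by
  have hm : ∀ t : ℝ, Measurable (Function.uncurry fun x s : ℝ => Real.cos (t * x) *
      ((1 - Real.cos (s * x)) * |x| ^ (-(1 + 1) : ℝ) * (Real.pi⁻¹ * polyaWeight α s))) := fun t => by fun_prop
  have hbase : Integrable (Function.uncurry fun x s : ℝ => Real.cos (0 * x) *
      ((1 - Real.cos (s * x)) * |x| ^ (-(1 + 1) : ℝ) * (Real.pi⁻¹ * polyaWeight α s)))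
      (volume.prod (volume.restrict (Ioi 0))) := by
    rw [integrable_prod_iff' (hm 0).aestronglyMeasurable]
    constructor
    · refine (ae_restrict_iff' measurableSet_Ioi).2 (ae_of_all _ fun s hs => ?_)
      refine ((integrable_and_integral_fejer 0 s hs).1.mul_const (Real.pi⁻¹ * polyaWeight α s)).congr
        (ae_of_all _ fun x => ?_)
      simp only [Function.uncurry]
      ring
    · have := (polya_representation h0 h1 le_rfl).1
      refine this.congr_fun (fun s hs => ?_) measurableSet_Ioi
      have hs' : 0 < s := hs
      have hw := polyaWeight_nonneg h0 h1 hs'.le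
      have hv := (integrable_and_integral_fejer 0 s hs).2
      simp only [abs_zero, sub_zero, max_eq_left hs'.le] at hv
      have hpi := Real.pi_pos
      calc polyaWeight α s * (s - 0) = (Real.pi * s) * (Real.pi⁻¹ * polyaWeight α s) := by field_simp; ring
        _ = _ := by
          rw [← hv, ← integral_mul_const]
          congr with x
          have : 0 ≤ 1 - Real.cos (s * x) := by linarith [Real.cos_le_one (s * x)]
          simp only [Function.uncurry, zero_mul, Real.cos_zero, one_mul]
          rw [Real.norm_of_nonneg (by positivity)]
  refine hbase.mono (hm t).aestronglyMeasurable (ae_of_all _ fun p => ?_)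
  simp only [Function.uncurry, zero_mul, Real.cos_zero, one_mul]
  rw [norm_mul]
  exact mul_le_of_le_one_left (norm_nonneg _) (Real.abs_cos_le_one _)

theorem integrable_stableDensity {α : ℝ} (h0 : 0 < α) (h1 : α < 1) : Integrable (stableDensity α) := by
  have := (integrable_fejer_mul_polyaWeight h0 h1 0).integral_prod_left
  refine this.congr (ae_of_all _ fun x => ?_)
  simp only [Function.uncurry, zero_mul, Real.cos_zero, one_mul, stableDensity]

theorem integral_cos_mul_stableDensity {α : ℝ} (h0 : 0 < α) (h1 : α < 1) (t : ℝ) :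
    ∫ x, Real.cos (t * x) * stableDensity α x = Real.exp (-(|t| ^ α)) := by
  have h := integral_integral_swap (integrable_fejer_mul_polyaWeight h0 h1 t)
  simp_rw [integral_const_mul] at h
  rw [← (polya_representation h0 h1 (abs_nonneg t)).2]
  refine h.trans ?_
  calc _ = ∫ s in Ioi (0 : ℝ), max (s - |t|) 0 * polyaWeight α s := by
        refine setIntegral_congr_fun measurableSet_Ioi fun s hs => ?_
        have hv := (integrable_and_integral_fejer t s hs).2
        have hpi := Real.pi_pos
        calc _ = ∫ x, Real.cos (t * x) * ((1 - Real.cos (s * x)) * |x| ^ (-(1 + 1) : ℝ))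
              * (Real.pi⁻¹ * polyaWeight α s) := by simp_rw [mul_assoc]
          _ = _ := by rw [integral_mul_const, hv]; field_simp
    _ = ∫ s in Ioi |t|, max (s - |t|) 0 * polyaWeight α s := by
        refine setIntegral_eq_of_subset_of_forall_sdiff_eq_zero measurableSet_Ioi
          (Ioi_subset_Ioi (abs_nonneg t)) fun s hs => ?_
        rw [max_eq_right (by have : ¬ |t| < s := hs.2; linarith), zero_mul]
    _ = _ := by
        refine setIntegral_congr_fun measurableSet_Ioi fun s hs => ?_
        rw [max_eq_left (sub_nonneg.2 (le_of_lt hs)), mul_comm]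

/-- Both sides have the same characteristic function. In particular `α` alone determines the law, so
the `S i` are identically distributed. -/
theorem eq_withDensity_stableDensity {α : ℝ} (h0 : 0 < α) (h1 : α < 1) {μ : Measure ℝ}
    (hμ : IsStdStable α μ) :
    μ = volume.withDensity fun x => ENNReal.ofReal (stableDensity α x) := by
  have := hμ.1
  have : IsFiniteMeasure (volume.withDensity fun x => ENNReal.ofReal (stableDensity α x)) :=
    isFiniteMeasure_withDensity_ofReal (integrable_stableDensity h0 h1).2
  refine Measure.ext_of_charFun (funext fun t => ?_)
  rw [hμ.2, charFun_withDensity_of_even (measurable_stableDensity α) (stableDensity_nonneg h0 h1)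
    (stableDensity_neg α) (integrable_stableDensity h0 h1), integral_cos_mul_stableDensity h0 h1]

/-- The substitution `v = s x`, which moves `x` out of the oscillating factor and into the Pólya
weight. -/
theorem stableDensity_eq_integral {α x : ℝ} (hx : 0 < x) :
    x ^ (1 + α) * stableDensity α x
      = ∫ v in Ioi (0 : ℝ), (1 - Real.cos v) * (Real.pi⁻¹ * (x ^ (α - 2) * polyaWeight α (x⁻¹ * v))) := by
  have h := integral_comp_mul_left_Ioi
    (fun v => (1 - Real.cos v) * (Real.pi⁻¹ * (x ^ (α - 2) * polyaWeight α (x⁻¹ * v)))) 0 hx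
  rw [mul_zero, smul_eq_mul, eq_comm, inv_mul_eq_iff_eq_mul₀ hx.ne'] at h
  rw [h, stableDensity, ← integral_const_mul, ← integral_const_mul]
  congr with s
  rw [inv_mul_cancel_left₀ hx.ne', abs_of_pos hx, mul_comm s x]
  have e1 : x ^ (1 + α) = x ^ α * x := by rw [Real.rpow_add hx, Real.rpow_one, mul_comm]
  have e2 : x ^ (-(1 + 1) : ℝ) = (x ^ 2)⁻¹ := by
    rw [Real.rpow_neg hx.le, show (1 + 1 : ℝ) = (2 : ℕ) by norm_num, Real.rpow_natCast]
  have e3 : x ^ (α - 2) = x ^ α / x ^ 2 := by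
    rw [← Real.rpow_natCast, ← Real.rpow_sub hx]; norm_num
  rw [e1, e2, e3]
  field_simp

theorem scaled_polyaWeight_le {α x v : ℝ} (h0 : 0 < α) (h1 : α < 1) (hx : 0 < x) (hv : 0 < v) :
    x ^ (α - 2) * polyaWeight α (x⁻¹ * v) ≤ α * v ^ (α - 2) := by
  have := polyaWeight_le h0 h1 (by positivity : 0 < x⁻¹ * v)
  calc _ ≤ x ^ (α - 2) * (α * (x⁻¹ * v) ^ (α - 2)) := by gcongr
    _ = _ := by
      rw [Real.mul_rpow (by positivity) hv.le, Real.inv_rpow hx.le]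
      have : 0 < x ^ (α - 2) := by positivity
      field_simp

theorem integrable_stableDensity_bound {α : ℝ} (h0 : 0 < α) (h1 : α < 1) :
    IntegrableOn (fun v : ℝ => (1 - Real.cos v) * v ^ (α - 2)) (Ioi 0) ∧
      ∫ v in Ioi (0 : ℝ), (1 - Real.cos v) * v ^ (α - 2) = ((1 - α) * tailConst (1 - α))⁻¹ := by
  have := integrableOn_and_integral_one_sub_cos_mul (α := 1 - α) (by linarith) (by linarith) one_pos
  simpa [show -(1 + (1 - α)) = α - 2 by ring] using this

theorem scaled_integrand_bound {α x v : ℝ} (h0 : 0 < α) (h1 : α < 1) (hx : 0 < x) (hv : 0 < v) :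
    ‖(1 - Real.cos v) * (Real.pi⁻¹ * (x ^ (α - 2) * polyaWeight α (x⁻¹ * v)))‖
      ≤ (Real.pi⁻¹ * α) * ((1 - Real.cos v) * v ^ (α - 2)) := by
  have hw := polyaWeight_nonneg h0 h1 (by positivity : 0 ≤ x⁻¹ * v)
  have hc : 0 ≤ 1 - Real.cos v := by linarith [Real.cos_le_one v]
  have hpi := Real.pi_pos
  rw [Real.norm_of_nonneg (by positivity)]
  calc _ ≤ (1 - Real.cos v) * (Real.pi⁻¹ * (α * v ^ (α - 2))) := by
        have := scaled_polyaWeight_le h0 h1 hx hv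
        exact mul_le_mul_of_nonneg_left (mul_le_mul_of_nonneg_left this (by positivity)) hc
    _ = _ := by ring

theorem exists_stableDensity_le {α : ℝ} (h0 : 0 < α) (h1 : α < 1) :
    ∃ K, 0 < K ∧ ∀ x, 0 < x → x ^ (1 + α) * stableDensity α x ≤ K := by
  obtain ⟨hi, hv⟩ := integrable_stableDensity_bound h0 h1
  have hC := tailConst_pos (α := 1 - α) (by linarith) (by linarith)
  have h1' : 0 < 1 - α := by linarith
  have hpi := Real.pi_pos
  refine ⟨(Real.pi⁻¹ * α) * ((1 - α) * tailConst (1 - α))⁻¹, by positivity, fun x hx => ?_⟩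
  rw [stableDensity_eq_integral hx, ← hv, ← integral_const_mul]
  refine (Real.le_norm_self _).trans (norm_integral_le_of_norm_le (hi.const_mul (Real.pi⁻¹ * α)) ?_)
  exact (ae_restrict_iff' measurableSet_Ioi).2 (ae_of_all _ fun v hv => scaled_integrand_bound h0 h1 hx hv)

/-- The limit of the density involves `C_(1 - α)`; Euler's reflection formula and the double angle
formula for the sine convert it to `C_α`. -/
theorem tailConst_reflection {α : ℝ} (h0 : 0 < α) (h1 : α < 1) :
    Real.pi⁻¹ * (α * (1 - α)) * ((1 - α) * tailConst (1 - α))⁻¹ = α * tailConst α / 2 := by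
  have hpi := Real.pi_pos
  have hG1 := Real.Gamma_pos_of_pos h0
  have hG2 := Real.Gamma_pos_of_pos (by linarith : 0 < 1 - α)
  have h1' : 0 < 1 - α := by linarith
  have hs : 0 < Real.sin (Real.pi * α / 2) :=
    Real.sin_pos_of_pos_of_lt_pi (by positivity) (by nlinarith)
  have hcpos : 0 < Real.cos (Real.pi * α / 2) :=
    Real.cos_pos_of_mem_Ioo ⟨by nlinarith, by nlinarith⟩
  have hr := Real.Gamma_mul_Gamma_one_sub α
  rw [show Real.pi * α = 2 * (Real.pi * α / 2) by ring, Real.sin_two_mul] at hr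
  have hc : Real.sin (Real.pi * (1 - α) / 2) = Real.cos (Real.pi * α / 2) := by
    rw [← Real.sin_pi_div_two_sub]; ring_nf
  rw [tailConst, tailConst, hc]
  rw [eq_div_iff (by positivity)] at hr
  field_simp
  linear_combination (-1 : ℝ) * hr

/-- As `x → ∞` the rescaled Pólya weight tends to `α (1 - α) v ^ (α - 2)` and stays below `α v ^ (α
- 2)`, so dominated convergence applies. -/
theorem tendsto_rpow_mul_stableDensity {α : ℝ} (h0 : 0 < α) (h1 : α < 1) :
    Tendsto (fun x => x ^ (1 + α) * stableDensity α x) atTop (𝓝 (α * tailConst α / 2)) := by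
  obtain ⟨hi, hv⟩ := integrable_stableDensity_bound h0 h1
  have hlim : Tendsto (fun x : ℝ => ∫ v in Ioi (0 : ℝ),
      (1 - Real.cos v) * (Real.pi⁻¹ * (x ^ (α - 2) * polyaWeight α (x⁻¹ * v)))) atTop
      (𝓝 (∫ v in Ioi (0 : ℝ), (1 - Real.cos v) * (Real.pi⁻¹ * (α * (1 - α) * v ^ (α - 2))))) := by
    refine tendsto_integral_filter_of_dominated_convergence
      (fun v => (Real.pi⁻¹ * α) * ((1 - Real.cos v) * v ^ (α - 2))) ?_ ?_ (hi.const_mul _) ?_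
    · refine Eventually.of_forall fun x => ?_
      have : Measurable fun v => (1 - Real.cos v) * (Real.pi⁻¹ * (x ^ (α - 2) * polyaWeight α (x⁻¹ * v))) := by
        fun_prop
      exact this.aestronglyMeasurable
    · filter_upwards [eventually_gt_atTop 0] with x hx
      exact (ae_restrict_iff' measurableSet_Ioi).2 (ae_of_all _ fun v hv => scaled_integrand_bound h0 h1 hx hv)
    · refine (ae_restrict_iff' measurableSet_Ioi).2 (ae_of_all _ fun v hv => ?_)
      have hv' : 0 < v := hv
      refine ((Tendsto.const_mul _ ?_).const_mul _)
      have hpow : Tendsto (fun x : ℝ => x ^ (-α)) atTop (𝓝 0) := tendsto_rpow_neg_atTop h0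
      have hexp : Tendsto (fun x : ℝ => Real.exp (-(v ^ α * x ^ (-α)))) atTop (𝓝 1) := by
        have := (Real.continuous_exp.tendsto _).comp ((hpow.const_mul (v ^ α)).neg)
        simpa [Function.comp_def] using this
      have := (((hpow.const_mul (α ^ 2 * v ^ (2 * α - 2))).const_add (α * (1 - α) * v ^ (α - 2))).mul hexp)
      simp only [mul_zero, add_zero, mul_one] at this
      refine this.congr' ((eventually_gt_atTop 0).mono fun x hx => ?_)
      simp only [polyaWeight]
      rw [Real.mul_rpow (by positivity) hv'.le, Real.mul_rpow (by positivity) hv'.le,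
        Real.mul_rpow (by positivity) hv'.le, Real.inv_rpow hx.le, Real.inv_rpow hx.le, Real.inv_rpow hx.le,
        Real.rpow_neg hx.le]
      have e : x ^ (2 * α - 2) = x ^ (α - 2) * x ^ α := by rw [← Real.rpow_add hx]; ring_nf
      rw [e, mul_comm (v ^ α)]
      have : 0 < x ^ (α - 2) := by positivity
      have : 0 < x ^ α := by positivity
      field_simp
  have hval : ∫ v in Ioi (0 : ℝ), (1 - Real.cos v) * (Real.pi⁻¹ * (α * (1 - α) * v ^ (α - 2)))
      = α * tailConst α / 2 := by
    rw [← tailConst_reflection h0 h1, ← hv, ← integral_const_mul]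
    congr with v
    ring
  rw [hval] at hlim
  exact hlim.congr' ((eventually_gt_atTop 0).mono fun x hx => (stableDensity_eq_integral hx).symm)

end Density

/-! ### The spectral measure of `X`. -/

section Spectral

open Set

theorem isFiniteMeasure_spectralMeas (α a : ℝ) : IsFiniteMeasure (spectralMeas α a) := by
  unfold spectralMeas
  have h : ∀ (c : ℝ) (ν : Measure (USphere 3)) [IsFiniteMeasure ν], IsFiniteMeasure (ENNReal.ofReal c • ν) :=
    fun c ν _ => Measure.smul_finite ν ENNReal.ofReal_ne_top
  have h1 := h (a ^ α * 3 ^ (α / 2) / 2) (Measure.dirac diagDir + Measure.dirac (-diagDir))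
  have h2 := h ((1 - a ^ α) / 2) (∑ i : Fin 3, (Measure.dirac (axisDir i) + Measure.dirac (-axisDir i)))
  infer_instance

theorem map_neg_spectralMeas (α a : ℝ) : (spectralMeas α a).map (fun x => -x) = spectralMeas α a := by
  have hm : Measurable fun x : USphere 3 => -x := continuous_neg.measurable
  simp only [spectralMeas, Fin.sum_univ_three]
  rw [Measure.map_add _ _ hm, Measure.map_smul, Measure.map_smul, Measure.map_add _ _ hm, Measure.map_add _ _ hm,
    Measure.map_add _ _ hm, Measure.map_add _ _ hm, Measure.map_add _ _ hm, Measure.map_add _ _ hm]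
  rw [Measure.map_dirac' hm, Measure.map_dirac' hm, Measure.map_dirac' hm, Measure.map_dirac' hm,
    Measure.map_dirac' hm, Measure.map_dirac' hm, Measure.map_dirac' hm, Measure.map_dirac' hm,
    neg_neg, neg_neg, neg_neg, neg_neg, add_comm (Measure.dirac (-diagDir)),
    add_comm (Measure.dirac (-axisDir 0)), add_comm (Measure.dirac (-axisDir 1)),
    add_comm (Measure.dirac (-axisDir 2))]

theorem integral_spectralMeas {α a : ℝ} (ha0 : 0 ≤ a) (ha1 : a ^ α ≤ 1) {f : USphere 3 → ℝ}
    (hf : Continuous f) (heven : ∀ x, f (-x) = f x) :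
    ∫ x, f x ∂(spectralMeas α a) = a ^ α * 3 ^ (α / 2) * f diagDir
      + (1 - a ^ α) * (f (axisDir 0) + f (axisDir 1) + f (axisDir 2)) := by
  have hi : ∀ (ν : Measure (USphere 3)) [IsFiniteMeasure ν], Integrable f ν := fun ν _ =>
    hf.integrable_of_hasCompactSupport (HasCompactSupport.of_compactSpace f)
  have hA : 0 ≤ a ^ α * 3 ^ (α / 2) / 2 := by positivity
  have hB : 0 ≤ (1 - a ^ α) / 2 := by linarith
  unfold spectralMeas
  rw [integral_add_measure ((hi _).smul_measure ENNReal.ofReal_ne_top)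
    ((hi _).smul_measure ENNReal.ofReal_ne_top), integral_smul_measure, integral_smul_measure,
    Fin.sum_univ_three]
  simp only [integral_add_measure (hi _) (hi _), integral_dirac, heven, ENNReal.toReal_ofReal hA,
    ENNReal.toReal_ofReal hB, smul_eq_mul]
  ring

theorem charFun_map_vecX {Ω : Type*} [MeasurableSpace Ω] (P : Measure Ω) [IsProbabilityMeasure P]
    {α a : ℝ} {S : Fin 4 → Ω → ℝ} (hS_meas : ∀ i, Measurable (S i)) (hS_indep : iIndepFun S P)
    (hS_law : ∀ i, IsStdStable α (P.map (S i))) (θ : RVec 3) :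
    charFun (P.map (vecX α a S)) θ = ((Real.exp (-(|a * (θ 0 + θ 1 + θ 2)| ^ α
      + |(1 - a ^ α) ^ (1 / α) * θ 0| ^ α + |(1 - a ^ α) ^ (1 / α) * θ 1| ^ α
      + |(1 - a ^ α) ^ (1 / α) * θ 2| ^ α)) : ℝ) : ℂ) := by
  have hX : Measurable (vecX α a S) := by
    unfold vecX
    refine (WithLp.measurable_toLp 2 _).comp (measurable_pi_lambda _ fun i => ?_)
    exact ((hS_meas 0).const_mul _).add ((hS_meas _).const_mul _)
  set b := (1 - a ^ α) ^ (1 / α)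
  -- The inner product of `θ` with `X` is `∑ j, c j * S j`, a combination of independent variables.
  set c : Fin 4 → ℝ := ![a * (θ 0 + θ 1 + θ 2), b * θ 0, b * θ 1, b * θ 2] with hc
  have h1 : charFun (P.map (vecX α a S)) θ = charFun (P.map fun ω => ∑ j, c j * S j ω) 1 := by
    rw [charFun_apply, charFun_apply, integral_map hX.aemeasurable (by fun_prop),
      integral_map (by fun_prop) (by fun_prop)]
    congr with ω
    congr 3
    simp [PiLp.inner_apply, Fin.sum_univ_succ, vecX, hc, b]
    ring
  have hind : iIndepFun (fun j ω => c j * S j ω) P :=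
    hS_indep.comp (fun j x => c j * x) fun j => by fun_prop
  rw [h1, iIndepFun.charFun_map_fun_sum_eq_prod (fun j => by fun_prop) hind]
  simp only [Finset.prod_apply, charFun_map_mul_comp (hS_meas _).aemeasurable, mul_one, (hS_law _).2]
  rw [← Complex.ofReal_prod, ← Real.exp_sum]
  congr 2
  simp [Fin.sum_univ_succ, hc]
  ring

theorem isSpectralMeasure_spectralMeas {Ω : Type*} [MeasurableSpace Ω] (P : Measure Ω) [IsProbabilityMeasure P]
    {α a : ℝ} (hα0 : 0 < α) (ha0 : 0 < a) (ha1 : a < 1)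
    {S : Fin 4 → Ω → ℝ} (hS_meas : ∀ i, Measurable (S i)) (hS_indep : iIndepFun S P)
    (hS_law : ∀ i, IsStdStable α (P.map (S i))) :
    IsSpectralMeasure α (P.map (vecX α a S)) (spectralMeas α a) := by
  refine ⟨isFiniteMeasure_spectralMeas α a, map_neg_spectralMeas α a, fun θ => ?_⟩
  have hle : a ^ α ≤ 1 := Real.rpow_le_one ha0.le ha1.le hα0.le
  have hb : ∀ x : ℝ, |(1 - a ^ α) ^ (1 / α) * x| ^ α = (1 - a ^ α) * |x| ^ α := fun x => by
    rw [abs_mul, Real.mul_rpow (abs_nonneg _) (abs_nonneg _), abs_of_nonneg (Real.rpow_nonneg (by linarith) _),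
      ← Real.rpow_mul (by linarith), one_div, inv_mul_cancel₀ hα0.ne', Real.rpow_one]
  rw [charFun_map_vecX P hS_meas hS_indep hS_law]
  have hcont : Continuous fun x : USphere 3 => |inner ℝ θ (x : RVec 3)| ^ α :=
    (by fun_prop : Continuous fun x : USphere 3 => |inner ℝ θ (x : RVec 3)|).rpow_const fun _ => Or.inr hα0.le
  rw [integral_spectralMeas ha0.le hle hcont (fun x => by simp)]
  congr 3
  have hd : inner ℝ θ (diagDir : RVec 3) = (Real.sqrt 3)⁻¹ * (θ 0 + θ 1 + θ 2) := by
    simp [diagDir, PiLp.inner_apply, Fin.sum_univ_three]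
    ring
  have hs : ∀ i, inner ℝ θ (axisDir i : RVec 3) = θ i := fun i => by
    simp [axisDir, EuclideanSpace.inner_single_right]
  have h3 : |(Real.sqrt 3)⁻¹| ^ α = (3 ^ (α / 2))⁻¹ := by
    rw [abs_of_pos (by positivity), Real.inv_rpow (by positivity), Real.sqrt_eq_rpow, ← Real.rpow_mul (by norm_num)]
    congr 2; ring
  rw [hd, hs, hs, hs, hb, hb, hb, abs_mul, abs_mul, Real.mul_rpow (abs_nonneg _) (abs_nonneg _),
    Real.mul_rpow (abs_nonneg _) (abs_nonneg _), h3, abs_of_pos ha0]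
  field_simp
  ring

end Spectral

/-! ### Asymptotics of the mixture integral. -/

section Limit

open Set

/-- The limit integral lives on `v > 1`, but the dominating function is needed from `v = 1/2` on; it
is integrable across `1` because `α < 1`. -/
theorem integrableOn_beta {α : ℝ} (h0 : 0 < α) (h1 : α < 1) :
    IntegrableOn (fun v : ℝ => v ^ (-(1 + α)) * |v - 1| ^ (-α)) (Ioi 2⁻¹) ∧
      ∫ v in Ioi (1 : ℝ), v ^ (-(1 + α)) * |v - 1| ^ (-α)
        = Real.Gamma (2 * α) * Real.Gamma (1 - α) / Real.Gamma (1 + α) := by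
  have hG := Real.Gamma_pos_of_pos (by linarith : 0 < 2 * α)
  have hG1 := Real.Gamma_pos_of_pos (by linarith : 0 < 1 - α)
  have hG2 := Real.Gamma_pos_of_pos (by linarith : 0 < 1 + α)
  have he : EqOn (fun v : ℝ => v ^ (-(1 + α)) * |v - 1| ^ (-α)) (fun v => v ^ (-(1 + α)) * (v - 1) ^ (-α)) (Ioi 1) :=
    fun v hv => by simp only [abs_of_pos (sub_pos.2 (mem_Ioi.1 hv))]
  obtain ⟨hi, hv⟩ := integrableOn_and_integral_of_lintegral_ofReal measurableSet_Ioi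
    (f := fun v : ℝ => v ^ (-(1 + α)) * (v - 1) ^ (-α)) (by fun_prop)
    (fun v hv => by
      have h1 : 1 < v := hv
      have h2 : 0 < v - 1 := by linarith
      positivity) (by positivity) (lintegral_Ioi_one_beta h0 h1)
  refine ⟨?_, by rw [setIntegral_congr_fun measurableSet_Ioi he, hv]⟩
  rw [← Ioc_union_Ioi_eq_Ioi (by norm_num : (2⁻¹ : ℝ) ≤ 1)]
  refine IntegrableOn.union ?_ (hi.congr_fun he.symm measurableSet_Ioi)
  have h2 : IntegrableOn (fun v : ℝ => (1 - v) ^ (-α)) (Ioc 2⁻¹ 1) := by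
    have := (intervalIntegral.intervalIntegrable_rpow' (r := -α) (a := 2⁻¹) (b := 0) (by linarith)).comp_sub_left 1
    rw [← intervalIntegrable_iff_integrableOn_Ioc_of_le (by norm_num)]
    convert this using 1 <;> norm_num
  have hm : Measurable fun v : ℝ => v ^ (-(1 + α)) * |v - 1| ^ (-α) := by fun_prop
  refine Integrable.mono' (h2.const_mul ((2⁻¹ : ℝ) ^ (-(1 + α)))) hm.aestronglyMeasurable ?_
  refine (ae_restrict_iff' measurableSet_Ioc).2 (ae_of_all _ fun v hv => ?_)
  have hv0 : 0 < v := by linarith [hv.1]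
  rw [Real.norm_of_nonneg (by positivity), abs_sub_comm, abs_of_nonneg (by linarith [hv.2])]
  refine mul_le_mul_of_nonneg_right ?_ (Real.rpow_nonneg (by linarith [hv.2]) _)
  exact Real.rpow_le_rpow_of_nonpos (by norm_num) hv.1.le (by linarith)

/-- The properties of the tail function `T` of `S_α` and of its density `f` which determine the
decay of mixtures of `T`. -/
structure StableTail (α c M K : ℝ) (T f : ℝ → ℝ) : Prop where
  measurable_tail : Measurable T
  nonneg : ∀ y, 0 ≤ T y
  add_neg : ∀ y, T y + T (-y) = 1
  tail_le : ∀ y, 0 < y → T y ≤ M * y ^ (-α)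
  tendsto_tail : Tendsto (fun y => y ^ α * T y) atTop (𝓝 c)
  measurable_density : Measurable f
  density_nonneg : ∀ x, 0 ≤ f x
  density_integrable : Integrable f
  density_integral : ∫ x, f x = 1
  density_le : ∀ x, 0 < x → x ^ (1 + α) * f x ≤ K
  tendsto_density : Tendsto (fun x => x ^ (1 + α) * f x) atTop (𝓝 (α * c))

namespace StableTail

variable {α c M K a b : ℝ} {T f : ℝ → ℝ}

theorem le_one (hT : StableTail α c M K T f) (y : ℝ) : T y ≤ 1 := by
  linarith [hT.add_neg y, hT.nonneg (-y)]

theorem bound_nonneg (hT : StableTail α c M K T f) : 0 ≤ M := by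
  have := (hT.nonneg 1).trans (hT.tail_le 1 one_pos)
  simpa using this

theorem density_bound_nonneg (hT : StableTail α c M K T f) : 0 ≤ K := by
  refine le_trans ?_ (hT.density_le 1 one_pos)
  simpa using hT.density_nonneg 1

theorem tendsto_zero (hT : StableTail α c M K T f) (h0 : 0 < α) : Tendsto T atTop (𝓝 0) := by
  have := (tendsto_rpow_neg_atTop h0).mul hT.tendsto_tail
  rw [zero_mul] at this
  refine this.congr' ((eventually_gt_atTop 0).mono fun y hy => ?_)
  rw [Real.rpow_neg hy.le, inv_mul_cancel_left₀ (by positivity)]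

theorem tendsto_one (hT : StableTail α c M K T f) (h0 : 0 < α) : Tendsto T atBot (𝓝 1) := by
  have := ((hT.tendsto_zero h0).comp tendsto_neg_atBot_atTop).const_sub 1
  rw [sub_zero] at this
  refine this.congr fun y => ?_
  simp only [Function.comp]
  linarith [hT.add_neg y]

/-- For either sign of `y` one of the factors is a tail at `|y|`, and the others are at most `1`. -/
theorem mul_le (hT : StableTail α c M K T f) {y : ℝ} (hy : y ≠ 0) :
    T y ^ 2 * T (-y) ≤ M * |y| ^ (-α) := by
  have a1 := hT.nonneg y
  have a2 := hT.nonneg (-y)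
  have a3 := hT.le_one y
  have a4 := hT.le_one (-y)
  rcases lt_or_gt_of_ne hy with h | h
  · have := hT.tail_le (-y) (by linarith)
    rw [abs_of_neg h]
    refine le_trans ?_ this
    exact mul_le_of_le_one_left a2 (pow_le_one₀ a1 a3)
  · have := hT.tail_le y h
    rw [abs_of_pos h]
    refine le_trans ?_ this
    nlinarith [mul_nonneg a1 (sub_nonneg.2 a3), mul_nonneg (mul_nonneg a1 a1) (sub_nonneg.2 a4)]

theorem tendsto_rpow_mul_comp (hT : StableTail α c M K T f) {l : ℝ} (hl : 0 < l) {g : ℝ → ℝ}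
    (hg : Tendsto g atTop atTop) (hgl : Tendsto (fun h => h / g h) atTop (𝓝 l)) :
    Tendsto (fun h => h ^ α * T (g h)) atTop (𝓝 (l ^ α * c)) := by
  have h1 := (hgl.rpow_const (p := α) (Or.inl hl.ne')).mul (hT.tendsto_tail.comp hg)
  refine h1.congr' ?_
  filter_upwards [hg.eventually_gt_atTop 0, eventually_gt_atTop 0] with h hgh hh
  simp only [Function.comp]
  rw [Real.div_rpow hh.le hgh.le]
  field_simp

/-- The range `a s ≤ h / 2`: then `y ≥ h / (2 b)`, so `h ^ α T(y)` is bounded and tends to `b ^ α c`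
for fixed `s`, while `T(-y) → 1`. The two factors `T(y)` absorb all of `h ^ (2α)`. -/
theorem tendsto_near (hT : StableTail α c M K T f) (h0 : 0 < α) (ha : 0 < a) (hb : 0 < b) :
    Tendsto (fun h : ℝ => ∫ s in Iic (h / a * 2⁻¹),
      h ^ (2 * α) * (f s * (T ((h - a * s) / b) ^ 2 * T (-((h - a * s) / b))))) atTop
      (𝓝 ((b ^ α * c) ^ 2)) := by
  have hMb := hT.bound_nonneg
  have hlim : (b ^ α * c) ^ 2 = ∫ s, (b ^ α * c) ^ 2 * f s := by
    rw [integral_const_mul, hT.density_integral, mul_one]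
  rw [hlim]
  simp_rw [← integral_indicator measurableSet_Iic]
  refine tendsto_integral_filter_of_dominated_convergence (fun s => (M * (2 * b) ^ α) ^ 2 * f s) ?_ ?_
    (hT.density_integrable.const_mul _) ?_
  · refine Eventually.of_forall fun h => ?_
    have m1 := hT.measurable_tail
    have m2 := hT.measurable_density
    have : Measurable fun s => h ^ (2 * α) * (f s * (T ((h - a * s) / b) ^ 2 * T (-((h - a * s) / b)))) := by
      fun_prop
    exact (this.indicator measurableSet_Iic).aestronglyMeasurable
  · filter_upwards [eventually_gt_atTop 0] with h hh
    refine ae_of_all _ fun s => ?_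
    have hf := hT.density_nonneg s
    by_cases hs : s ∈ Iic (h / a * 2⁻¹)
    · rw [indicator_of_mem hs]
      have hs' : a * s ≤ h / 2 := by
        have : s ≤ h / a * 2⁻¹ := hs
        calc a * s ≤ a * (h / a * 2⁻¹) := by gcongr
          _ = h / 2 := by field_simp
      set y := (h - a * s) / b with hy
      have hy1 : h / (2 * b) ≤ y := by
        rw [hy, div_le_div_iff₀ (by positivity) hb]
        nlinarith
      have hy0 : 0 < y := lt_of_lt_of_le (by positivity) hy1
      have a1 := hT.nonneg y
      have a2 := hT.nonneg (-y)
      have a4 := hT.le_one (-y)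
      have b1 : h ^ α * T y ≤ M * (2 * b) ^ α := by
        calc h ^ α * T y ≤ h ^ α * (M * y ^ (-α)) := by gcongr; exact hT.tail_le y hy0
          _ ≤ h ^ α * (M * (h / (2 * b)) ^ (-α)) := by
            have := Real.rpow_le_rpow_of_nonpos (by positivity) hy1 (by linarith : -α ≤ 0)
            exact mul_le_mul_of_nonneg_left (mul_le_mul_of_nonneg_left this hMb) (by positivity)
          _ = _ := by
            rw [Real.div_rpow hh.le (by positivity), Real.rpow_neg hh.le, Real.rpow_neg (by positivity)]
            field_simp
      have e : h ^ (2 * α) = h ^ α * h ^ α := by rw [← Real.rpow_add hh]; ring_nf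
      rw [Real.norm_of_nonneg (by positivity), e]
      calc _ = (h ^ α * T y) ^ 2 * T (-y) * f s := by ring
        _ ≤ (M * (2 * b) ^ α) ^ 2 * 1 * f s := by gcongr
        _ = _ := by ring
    · rw [indicator_of_notMem hs, norm_zero]
      positivity
  · refine ae_of_all _ fun s => ?_
    have hg : Tendsto (fun h : ℝ => (h - a * s) / b) atTop atTop :=
      (tendsto_atTop_add_const_right _ _ tendsto_id).atTop_div_const hb
    have hgl : Tendsto (fun h : ℝ => h / ((h - a * s) / b)) atTop (𝓝 b) := by
      have h1 : Tendsto (fun h : ℝ => b / (1 - a * s / h)) atTop (𝓝 (b / (1 - 0))) :=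
        tendsto_const_nhds.div (tendsto_const_nhds.sub (tendsto_const_nhds.div_atTop tendsto_id)) (by norm_num)
      rw [sub_zero, div_one] at h1
      refine h1.congr' ?_
      filter_upwards [eventually_gt_atTop 0] with h hh
      rw [div_div_eq_mul_div, one_sub_div hh.ne', div_div_eq_mul_div, mul_comm]
    have h1 := hT.tendsto_rpow_mul_comp hb hg hgl
    have h2 := (hT.tendsto_one h0).comp (tendsto_neg_atTop_atBot.comp hg)
    have h3 := ((h1.pow 2).mul h2).mul_const (f s)
    rw [mul_one] at h3
    refine h3.congr' ?_
    have hev : Tendsto (fun h : ℝ => h / a * 2⁻¹) atTop atTop :=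
      (tendsto_id.atTop_div_const ha).atTop_mul_const (by norm_num)
    filter_upwards [hev.eventually_ge_atTop s, eventually_gt_atTop 0] with h hs hh
    rw [indicator_of_mem (mem_Iic.2 hs)]
    have e : h ^ (2 * α) = h ^ α * h ^ α := by rw [← Real.rpow_add hh]; ring_nf
    rw [e]
    simp only [Function.comp]
    ring

/-- The substitution `s = h v / a`. One factor `h ^ α` is absorbed by the density of `S_0`, the
other stays with the tails. -/
theorem integral_far_eq (ha : 0 < a) {h : ℝ} (hh : 0 < h) :
    ∫ s in Ioi (h / a * 2⁻¹),
      h ^ (2 * α) * (f s * (T ((h - a * s) / b) ^ 2 * T (-((h - a * s) / b))))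
    = ∫ v in Ioi (2⁻¹ : ℝ), a ^ α * (v ^ (-(1 + α)) * (((h / a * v) ^ (1 + α) * f (h / a * v)) *
        (h ^ α * (T (h * (1 - v) / b) ^ 2 * T (-(h * (1 - v) / b)))))) := by
  have hha : 0 < h / a := by positivity
  rw [← integral_comp_mul_left_Ioi' _ _ hha, ← integral_smul]
  refine setIntegral_congr_fun measurableSet_Ioi fun v hv => ?_
  have hv0 : 0 < v := lt_trans (by norm_num) (mem_Ioi.1 hv)
  have e1 : h - a * (h / a * v) = h * (1 - v) := by field_simp
  simp only [smul_eq_mul, e1]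
  have e : h ^ (2 * α) = h ^ α * h ^ α := by rw [← Real.rpow_add hh]; ring_nf
  rw [e, Real.mul_rpow hha.le hv0.le, Real.div_rpow hh.le ha.le, Real.rpow_neg hv0.le, Real.rpow_add hh,
    Real.rpow_add ha, Real.rpow_one, Real.rpow_one]
  field_simp

/-- For `v > 1` the argument `y` tends to `-∞`, so only `T(-y)` decays, and it absorbs the remaining
`h ^ α`. For `1/2 < v < 1` both factors `T(y)` decay and the limit is `0`. -/
theorem tendsto_far (hT : StableTail α c M K T f) (h0 : 0 < α) (h1 : α < 1) (ha : 0 < a) (hb : 0 < b) :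
    Tendsto (fun h : ℝ => ∫ s in Ioi (h / a * 2⁻¹),
      h ^ (2 * α) * (f s * (T ((h - a * s) / b) ^ 2 * T (-((h - a * s) / b))))) atTop
      (𝓝 (a ^ α * b ^ α * α * c ^ 2 * (Real.Gamma (2 * α) * Real.Gamma (1 - α) / Real.Gamma (1 + α)))) := by
  obtain ⟨hi, hval⟩ := integrableOn_beta h0 h1
  have hMb := hT.bound_nonneg
  have hKb := hT.density_bound_nonneg
  refine Tendsto.congr' ((eventually_gt_atTop 0).mono fun h hh => (integral_far_eq ha hh).symm) ?_
  have hlim : a ^ α * b ^ α * α * c ^ 2 * (Real.Gamma (2 * α) * Real.Gamma (1 - α) / Real.Gamma (1 + α))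
      = ∫ v in Ioi (2⁻¹ : ℝ), (Ioi (1 : ℝ)).indicator
        (fun v => a ^ α * b ^ α * α * c ^ 2 * (v ^ (-(1 + α)) * |v - 1| ^ (-α))) v := by
    rw [setIntegral_indicator measurableSet_Ioi, inter_eq_self_of_subset_right (Ioi_subset_Ioi (by norm_num)),
      integral_const_mul, hval]
  rw [hlim]
  refine tendsto_integral_filter_of_dominated_convergence
    (fun v => a ^ α * K * M * b ^ α * (v ^ (-(1 + α)) * |v - 1| ^ (-α))) ?_ ?_ (hi.const_mul _) ?_
  · refine Eventually.of_forall fun h => ?_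
    have m1 := hT.measurable_tail
    have m2 := hT.measurable_density
    have : Measurable fun v => a ^ α * (v ^ (-(1 + α)) * (((h / a * v) ^ (1 + α) * f (h / a * v)) *
        (h ^ α * (T (h * (1 - v) / b) ^ 2 * T (-(h * (1 - v) / b)))))) := by
      fun_prop
    exact this.aestronglyMeasurable
  · filter_upwards [eventually_gt_atTop 0] with h hh
    have hne : ∀ᵐ v ∂(volume.restrict (Ioi (2⁻¹ : ℝ))), v ≠ 1 := Measure.ae_ne _ _
    filter_upwards [hne, ae_restrict_mem measurableSet_Ioi] with v hv1 hv
    have hv0 : 0 < v := lt_trans (by norm_num) (mem_Ioi.1 hv)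
    set y := h * (1 - v) / b with hy
    have hv2 : 0 < |v - 1| := abs_pos.2 (sub_ne_zero.2 hv1)
    have hyabs : |y| = h / b * |v - 1| := by
      rw [hy, abs_div, abs_mul, abs_of_pos hh, abs_of_pos hb, abs_sub_comm]; ring
    have hy0 : y ≠ 0 := abs_pos.1 (by rw [hyabs]; positivity)
    have b1 := hT.mul_le hy0
    have a1 := hT.nonneg y
    have a2 := hT.nonneg (-y)
    have b2 := hT.density_le (h / a * v) (by positivity)
    have a3 := hT.density_nonneg (h / a * v)
    rw [Real.norm_of_nonneg (by positivity)]
    have b3 : h ^ α * (T y ^ 2 * T (-y)) ≤ M * b ^ α * |v - 1| ^ (-α) := by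
      calc _ ≤ h ^ α * (M * |y| ^ (-α)) := by gcongr
        _ = _ := by
          rw [hyabs, Real.mul_rpow (by positivity) hv2.le, Real.div_rpow hh.le hb.le, Real.rpow_neg hh.le,
            Real.rpow_neg hb.le]
          field_simp
    calc _ ≤ a ^ α * (v ^ (-(1 + α)) * (K * (M * b ^ α * |v - 1| ^ (-α)))) := by gcongr
      _ = _ := by ring
  · have hne : ∀ᵐ v ∂(volume.restrict (Ioi (2⁻¹ : ℝ))), v ≠ 1 := Measure.ae_ne _ _
    filter_upwards [hne, ae_restrict_mem measurableSet_Ioi] with v hv1 hv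
    have hv0 : 0 < v := lt_trans (by norm_num) (mem_Ioi.1 hv)
    have hf : Tendsto (fun h : ℝ => (h / a * v) ^ (1 + α) * f (h / a * v)) atTop (𝓝 (α * c)) :=
      hT.tendsto_density.comp ((tendsto_id.atTop_div_const ha).atTop_mul_const hv0)
    rcases lt_or_gt_of_ne hv1 with hlt | hgt
    · rw [indicator_of_notMem (by simpa using hlt.le)]
      have hp : 0 < 1 - v := by linarith
      have hg : Tendsto (fun h : ℝ => h * (1 - v) / b) atTop atTop :=
        (tendsto_id.atTop_mul_const hp).atTop_div_const hb
      have hgl : Tendsto (fun h : ℝ => h / (h * (1 - v) / b)) atTop (𝓝 (b / (1 - v))) := by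
        refine tendsto_const_nhds.congr' ?_
        filter_upwards [eventually_gt_atTop 0] with h hh
        field_simp
      -- One factor `T(y)` compensates `h ^ α`; the second one still tends to `0`.
      have l1 := hT.tendsto_rpow_mul_comp (by positivity) hg hgl
      have l2 := (hT.tendsto_zero h0).comp hg
      have l3 := (hT.tendsto_one h0).comp (tendsto_neg_atTop_atBot.comp hg)
      have l4 := ((hf.mul ((l1.mul l2).mul l3)).const_mul (v ^ (-(1 + α)))).const_mul (a ^ α)
      simp only [mul_zero, zero_mul] at l4
      refine l4.congr fun h => ?_
      simp only [Function.comp]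
      ring
    · rw [indicator_of_mem (mem_Ioi.2 hgt)]
      have hp : 0 < v - 1 := by linarith
      have hg : Tendsto (fun h : ℝ => -(h * (1 - v) / b)) atTop atTop := by
        have := (tendsto_id.atTop_mul_const hp).atTop_div_const hb
        refine this.congr fun h => ?_
        simp only [id]
        ring
      have hgl : Tendsto (fun h : ℝ => h / -(h * (1 - v) / b)) atTop (𝓝 (b / (v - 1))) := by
        refine tendsto_const_nhds.congr' ?_
        filter_upwards [eventually_gt_atTop 0] with h hh
        rw [show -(h * (1 - v) / b) = h * (v - 1) / b by ring]
        field_simp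
      have l1 := hT.tendsto_rpow_mul_comp (by positivity) hg hgl
      have l2 := (hT.tendsto_one h0).comp (tendsto_neg_atTop_atBot.comp hg)
      have l4 := ((hf.mul (l1.mul (l2.pow 2))).const_mul (v ^ (-(1 + α)))).const_mul (a ^ α)
      have e : a ^ α * (v ^ (-(1 + α)) * (α * c * ((b / (v - 1)) ^ α * c * 1 ^ 2)))
          = a ^ α * b ^ α * α * c ^ 2 * (v ^ (-(1 + α)) * |v - 1| ^ (-α)) := by
        rw [Real.div_rpow hb.le hp.le, abs_of_pos hp, Real.rpow_neg hp.le]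
        field_simp
      rw [← e]
      refine l4.congr fun h => ?_
      simp only [Function.comp, neg_neg]
      ring

theorem tendsto_integral (hT : StableTail α c M K T f) (h0 : 0 < α) (h1 : α < 1) (ha : 0 < a) (hb : 0 < b) :
    Tendsto (fun h : ℝ => h ^ (2 * α) *
      ∫ s, f s * (T ((h - a * s) / b) ^ 2 * T (-((h - a * s) / b)))) atTop
      (𝓝 ((b ^ α * c) ^ 2 +
        a ^ α * b ^ α * α * c ^ 2 * (Real.Gamma (2 * α) * Real.Gamma (1 - α) / Real.Gamma (1 + α)))) := by
  refine ((hT.tendsto_near h0 ha hb).add (hT.tendsto_far h0 h1 ha hb)).congr fun h => ?_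
  have hint : Integrable fun s => f s * (T ((h - a * s) / b) ^ 2 * T (-((h - a * s) / b))) := by
    have m1 := hT.measurable_tail
    have m2 := hT.measurable_density
    refine hT.density_integrable.mono (by fun_prop) (ae_of_all _ fun s => ?_)
    have a1 := hT.nonneg ((h - a * s) / b)
    have a2 := hT.nonneg (-((h - a * s) / b))
    rw [norm_mul, Real.norm_of_nonneg (by positivity : 0 ≤ T ((h - a * s) / b) ^ 2 * T (-((h - a * s) / b)))]
    exact mul_le_of_le_one_right (norm_nonneg _)
      (mul_le_one₀ (pow_le_one₀ a1 (hT.le_one _)) a2 (hT.le_one _))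
  rw [← setIntegral_union (Iic_disjoint_Ioi le_rfl) measurableSet_Ioi (hint.const_mul _).integrableOn
    (hint.const_mul _).integrableOn, Iic_union_Ioi, setIntegral_univ, integral_const_mul]

end StableTail

end Limit

/-! ### Decay of the probability that `X` lies in `hE`. -/

section Decay

open Set

/-- The relation `T(y) + T(-y) = 1` comes from the evenness of the density and the absence of atoms.
-/
theorem stableTail_of_isStdStable {α : ℝ} (h0 : 0 < α) (h1 : α < 1) {μ : Measure ℝ} (hμ : IsStdStable α μ) :
    ∃ M K, StableTail α (tailConst α / 2) M K (fun y => μ.real (Ioi y)) (stableDensity α) := by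
  have := hμ.1
  have hd := eq_withDensity_stableDensity h0 h1 hμ
  have hac : μ ≪ volume := by
    rw [hd]
    exact withDensity_absolutelyContinuous _ _
  have hnoatom : ∀ x, μ {x} = 0 := fun x => hac (by simp)
  have hIci : ∀ y, μ (Ici y) = μ (Ioi y) := fun y => by
    refine le_antisymm ?_ (measure_mono Ioi_subset_Ici_self)
    rw [← Ioi_union_left]
    exact (measure_union_le _ _).trans (by rw [hnoatom, add_zero])
  have hneg : ∀ y, μ (Ioi (-y)) = μ (Iio y) := fun y => by
    conv_lhs => rw [hd]
    conv_rhs => rw [hd]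
    rw [withDensity_apply _ measurableSet_Ioi, withDensity_apply _ measurableSet_Iio,
      ← (Measure.measurePreserving_neg (volume : Measure ℝ)).setLIntegral_comp_preimage measurableSet_Ioi
        (measurable_stableDensity α).ennreal_ofReal]
    simp only [neg_preimage, neg_Ioi, neg_neg, stableDensity_neg]
  have htail : Tendsto (fun h : ℝ => h ^ α * μ.real (Ioi h)) atTop (𝓝 (tailConst α / 2)) := by
    have := tendsto_rpow_mul_measureReal_Ici h0 (by linarith) hμ
    simpa only [measureReal_def, hIci] using this
  obtain ⟨K, hK, hKb⟩ := exists_stableDensity_le h0 h1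
  obtain ⟨y₀, hy₀⟩ := eventually_atTop.1 (htail.eventually (gt_mem_nhds (lt_add_one (tailConst α / 2))))
  have hC := tailConst_pos h0 (by linarith : α < 2)
  -- Beyond `y₀` the convergence bounds `y ^ α T(y)` by its limit plus `1`; below `y₀` it is at most
  -- `y₀ ^ α` since `T ≤ 1`.
  refine ⟨tailConst α / 2 + 1 + (max y₀ 0) ^ α, K, ?_⟩
  refine
    { measurable_tail := ?_
      nonneg := fun y => measureReal_nonneg
      add_neg := fun y => ?_
      tail_le := fun y hy => ?_
      tendsto_tail := htail
      measurable_density := measurable_stableDensity α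
      density_nonneg := stableDensity_nonneg h0 h1
      density_integrable := integrable_stableDensity h0 h1
      density_integral := ?_
      density_le := hKb
      tendsto_density := ?_ }
  · have : Antitone fun y => μ.real (Ioi y) := fun x y hxy =>
      measureReal_mono (Ioi_subset_Ioi hxy)
    exact this.measurable
  · have e : μ.real (Ioi (-y)) = μ.real (Iio y) := by simp only [measureReal_def, hneg]
    have e2 : μ.real (Ioi y) = μ.real (Ici y) := by simp only [measureReal_def, hIci]
    rw [e, e2, ← compl_Ici, probReal_compl_eq_one_sub measurableSet_Ici]
    ring
  · have hyα : 0 < y ^ α := by positivity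
    rw [Real.rpow_neg hy.le, ← div_eq_mul_inv, le_div_iff₀ hyα, mul_comm]
    rcases le_total y₀ y with h | h
    · have := (hy₀ y h).le
      have : (0 : ℝ) ≤ (max y₀ 0) ^ α := by positivity
      linarith
    · have : y ^ α ≤ (max y₀ 0) ^ α := Real.rpow_le_rpow hy.le (h.trans (le_max_left _ _)) h0.le
      have : y ^ α * μ.real (Ioi y) ≤ y ^ α := mul_le_of_le_one_right hyα.le measureReal_le_one
      linarith
  · have := integral_cos_mul_stableDensity h0 h1 0
    simpa [Real.zero_rpow h0.ne'] using this
  · rw [← mul_div_assoc]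
    exact tendsto_rpow_mul_stableDensity h0 h1

/-- Condition on `S_0 = s`: the three coordinates become independent, and the event is a box in
`(S_1, S_2, S_3)`. -/
theorem measureReal_vecX_mem_smul_setE {Ω : Type*} [MeasurableSpace Ω] (P : Measure Ω) [IsProbabilityMeasure P]
    {α a : ℝ} {S : Fin 4 → Ω → ℝ} (hS_meas : ∀ i, Measurable (S i)) (hS_indep : iIndepFun S P)
    {μ : Measure ℝ} [IsProbabilityMeasure μ] (hμ : ∀ i, P.map (S i) = μ)
    (hb : 0 < (1 - a ^ α) ^ (1 / α)) {h : ℝ} (hh : 0 < h) :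
    P.real {ω | vecX α a S ω ∈ h • setE}
      = ∫ s, μ.real (Ioi ((h - a * s) / (1 - a ^ α) ^ (1 / α))) ^ 2
          * μ.real (Iio ((h - a * s) / (1 - a ^ α) ^ (1 / α))) ∂μ := by
  set b := (1 - a ^ α) ^ (1 / α) with hbdef
  set B : Set (Fin 4 → ℝ) := {s | h < a * s 0 + b * s 1 ∧ h < a * s 0 + b * s 2 ∧ a * s 0 + b * s 3 < h} with hB
  have hBm : MeasurableSet B := by
    rw [hB, ofPred_and, ofPred_and]
    exact (measurableSet_lt measurable_const (by fun_prop)).inter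
      ((measurableSet_lt measurable_const (by fun_prop)).inter
        (measurableSet_lt (by fun_prop) measurable_const))
  have hset : {ω | vecX α a S ω ∈ h • setE} = (fun ω i => S i ω) ⁻¹' B := by
    ext ω
    rw [mem_ofPred_eq, mem_smul_set_iff_inv_smul_mem₀ hh.ne']
    have e : ∀ x : ℝ, 1 < h⁻¹ * x ↔ h < x := fun x => by rw [lt_inv_mul_iff₀ hh, mul_one]
    have e' : ∀ x : ℝ, h⁻¹ * x < 1 ↔ x < h := fun x => by rw [inv_mul_lt_iff₀ hh, mul_one]
    simp only [setE, vecX, hB, mem_preimage, mem_ofPred_eq, PiLp.smul_apply, smul_eq_mul, e, e']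
    rfl
  have hlaw : P.map (fun ω i => S i ω) = Measure.pi fun _ : Fin 4 => μ := by
    rw [(iIndepFun_iff_map_fun_eq_pi_map fun i => (hS_meas i).aemeasurable).1 hS_indep]
    simp_rw [hμ]
  have hmp := measurePreserving_piFinSuccAbove (fun _ : Fin 4 => μ) 0
  set e := MeasurableEquiv.piFinSuccAbove (fun _ : Fin 4 => ℝ) 0
  have hBm' : MeasurableSet (e.symm ⁻¹' B) := e.symm.measurable hBm
  have hfib : ∀ s : ℝ, Prod.mk s ⁻¹' (e.symm ⁻¹' B)
      = univ.pi ![Ioi ((h - a * s) / b), Ioi ((h - a * s) / b), Iio ((h - a * s) / b)] := by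
    intro s
    ext x
    have hsymm : e.symm (s, x) = Fin.cons s x := by
      simp [e, MeasurableEquiv.piFinSuccAbove]
      rfl
    simp only [mem_preimage, hsymm, hB, mem_ofPred_eq, mem_univ_pi, Fin.forall_fin_succ, mem_Ioi, mem_Iio,
      Matrix.cons_val_zero, Matrix.cons_val_succ, div_lt_iff₀ hb, lt_div_iff₀ hb]
    have c1 : (Fin.cons s x : Fin 4 → ℝ) 0 = s := rfl
    have c2 : (Fin.cons s x : Fin 4 → ℝ) 1 = x 0 := rfl
    have c3 : (Fin.cons s x : Fin 4 → ℝ) 2 = x 1 := rfl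
    have c4 : (Fin.cons s x : Fin 4 → ℝ) 3 = x 2 := rfl
    rw [c1, c2, c3, c4]
    constructor
    · rintro ⟨p, q, r⟩
      refine ⟨by linarith, by change _ < x 1 * b; linarith, by change x 2 * b < _; linarith, fun i => i.elim0⟩
    · rintro ⟨p, q, r, -⟩
      change _ < x 1 * b at q
      change x 2 * b < _ at r
      exact ⟨by linarith, by linarith, by linarith⟩
  have hmeas : P {ω | vecX α a S ω ∈ h • setE} = ∫⁻ s, μ (Ioi ((h - a * s) / b)) ^ 2 * μ (Iio ((h - a * s) / b)) ∂μ := by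
    rw [hset, ← Measure.map_apply (by fun_prop) hBm, hlaw, ← (hmp.symm e).measure_preimage hBm.nullMeasurableSet,
      Measure.prod_apply hBm']
    refine lintegral_congr fun s => ?_
    rw [hfib, Measure.pi_pi, Fin.prod_univ_three]
    simp [sq]
  rw [measureReal_def, hmeas, ← integral_toReal]
  · simp only [ENNReal.toReal_mul, ENNReal.toReal_pow, measureReal_def]
  · have m1 : Measurable fun y => μ (Ioi y) :=
      (show Antitone fun y => μ (Ioi y) from fun x y hxy => measure_mono (Ioi_subset_Ioi hxy)).measurable
    have m2 : Measurable fun y => μ (Iio y) :=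
      (show Monotone fun y => μ (Iio y) from fun x y hxy => measure_mono (Iio_subset_Iio hxy)).measurable
    have hg : Measurable fun s : ℝ => (h - a * s) / b := by fun_prop
    exact (((m1.comp hg).pow_const 2).mul (m2.comp hg)).aemeasurable
  · exact ae_of_all _ fun s => ENNReal.mul_lt_top (ENNReal.pow_lt_top (measure_lt_top _ _)) (measure_lt_top _ _)

theorem tendsto_rpow_mul_measureReal_vecX {Ω : Type*} [MeasurableSpace Ω] (P : Measure Ω) [IsProbabilityMeasure P]
    {α a : ℝ} (h0 : 0 < α) (h1 : α < 1) (ha0 : 0 < a) (ha1 : a < 1)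
    {S : Fin 4 → Ω → ℝ} (hS_meas : ∀ i, Measurable (S i)) (hS_indep : iIndepFun S P)
    (hS_law : ∀ i, IsStdStable α (P.map (S i))) :
    Tendsto (fun h : ℝ => h ^ (2 * α) * P.real {ω | vecX α a S ω ∈ h • setE}) atTop (𝓝 (limitConst α a)) := by
  have hlt : a ^ α < 1 := Real.rpow_lt_one ha0.le ha1 h0
  have hb : 0 < (1 - a ^ α) ^ (1 / α) := Real.rpow_pos_of_pos (by linarith) _
  have hbα : ((1 - a ^ α) ^ (1 / α)) ^ α = 1 - a ^ α := by
    rw [← Real.rpow_mul (by linarith), one_div, inv_mul_cancel₀ h0.ne', Real.rpow_one]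
  set μ := P.map (S 0) with hμ
  have hd := eq_withDensity_stableDensity h0 h1 (hS_law 0)
  have hlaw : ∀ i, P.map (S i) = μ := fun i => by
    rw [hμ, hd]
    exact eq_withDensity_stableDensity h0 h1 (hS_law i)
  have hprob := (hS_law 0).1
  obtain ⟨M, K, hT⟩ := stableTail_of_isStdStable h0 h1 (hS_law 0)
  have hIio : ∀ y, μ.real (Iio y) = μ.real (Ioi (-y)) := fun y => by
    have h1 := hT.add_neg (-y)
    have h2 := hT.add_neg y
    have h3 : μ.real (Iic y) + μ.real (Ioi y) = 1 := by
      rw [← compl_Iic, probReal_compl_eq_one_sub measurableSet_Iic]; ring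
    have h4 : μ.real (Iio y) = μ.real (Iic y) := by
      have hac : μ ≪ volume := by
        rw [hμ, hd]
        exact withDensity_absolutelyContinuous _ _
      rw [measureReal_def, measureReal_def]
      congr 1
      exact measure_congr (hac.ae_eq Iio_ae_eq_Iic)
    rw [h4]
    linarith
  have key := hT.tendsto_integral h0 h1 ha0 hb
  rw [hbα] at key
  have e : ((1 - a ^ α) * (tailConst α / 2)) ^ 2 + a ^ α * (1 - a ^ α) * α * (tailConst α / 2) ^ 2
      * (Real.Gamma (2 * α) * Real.Gamma (1 - α) / Real.Gamma (1 + α)) = limitConst α a := by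
    rw [limitConst]; ring
  rw [e] at key
  refine key.congr' ((eventually_gt_atTop 0).mono fun h hh => ?_)
  beta_reduce
  rw [measureReal_vecX_mem_smul_setE P hS_meas hS_indep hlaw hb hh]
  simp_rw [hIio]
  conv_rhs => rw [hμ, hd]
  rw [integral_withDensity_ofReal (measurable_stableDensity α) (stableDensity_nonneg h0 h1)]
  simp_rw [smul_eq_mul, ← hd]

end Decay

/-! ### The functional `L` for `k = 2` as a sum over pairs of directions. -/

section TailFunctional

open Set

/-- The density `α s ^ (-(1 + α))`. -/
noncomputable def rayWeight (α s : ℝ) : ℝ≥0∞ := ENNReal.ofReal (α * s ^ (-(1 + α)))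

@[fun_prop]
theorem measurable_rayWeight (α : ℝ) : Measurable (rayWeight α) := by
  unfold rayWeight
  fun_prop

/-- The contribution of the directions `x`, `y` to `L(F, 2, α)`. -/
noncomputable def pairMass (α : ℝ) (F : Set (RVec 3)) (x y : USphere 3) : ℝ≥0∞ :=
  ∫⁻ s in Ioi (0 : ℝ), ∫⁻ t in Ioi (0 : ℝ),
    F.indicator 1 (s • (x : RVec 3) + t • (y : RVec 3)) * (rayWeight α s * rayWeight α t)

/-- Tonelli: integrate over the two radii first, with the two directions fixed. -/
theorem tailL_two_eq {Λ : Measure (USphere 3)} [IsFiniteMeasure Λ] {F : Set (RVec 3)} (hF : MeasurableSet F)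
    (α : ℝ) :
    tailL Λ F 2 α = ENNReal.ofReal (tailConst α ^ 2 / 2) * ∫⁻ x, ∫⁻ y, pairMass α F x y ∂Λ ∂Λ := by
  have hFi : Measurable (F.indicator (1 : RVec 3 → ℝ≥0∞)) := measurable_one.indicator hF
  rw [tailL]
  congr 1
  have hinner : ∀ s : Fin 2 → ℝ,
      Measure.pi (fun _ : Fin 2 => Λ) {x : Fin 2 → USphere 3 | ∑ i, s i • (x i : RVec 3) ∈ F}
        = ∫⁻ p, F.indicator 1 (s 0 • (p.1 : RVec 3) + s 1 • (p.2 : RVec 3)) ∂(Λ.prod Λ) := by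
    intro s
    have hm : Measurable fun p : USphere 3 × USphere 3 => s 0 • (p.1 : RVec 3) + s 1 • (p.2 : RVec 3) := by
      fun_prop
    have h1 : {x : Fin 2 → USphere 3 | ∑ i, s i • (x i : RVec 3) ∈ F}
        = (MeasurableEquiv.finTwoArrow (α := USphere 3)) ⁻¹'
          ((fun p : USphere 3 × USphere 3 => s 0 • (p.1 : RVec 3) + s 1 • (p.2 : RVec 3)) ⁻¹' F) := by
      ext x
      simp [Fin.sum_univ_two, MeasurableEquiv.finTwoArrow]
    rw [h1, (measurePreserving_finTwoArrow Λ).measure_preimage (hm hF).nullMeasurableSet,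
      ← lintegral_indicator_one (hm hF)]
    rfl
  simp_rw [hinner]
  have hR : (volume : Measure (Fin 2 → ℝ)).restrict (univ.pi fun _ : Fin 2 => Ioi (0 : ℝ))
      = Measure.pi fun _ : Fin 2 => (volume : Measure ℝ).restrict (Ioi 0) := by
    rw [volume_pi, Measure.restrict_pi_pi]
  have hmp := measurePreserving_finTwoArrow ((volume : Measure ℝ).restrict (Ioi 0))
  have hm3 : Measurable fun q : (ℝ × ℝ) × (USphere 3 × USphere 3) =>
      F.indicator (1 : RVec 3 → ℝ≥0∞) (q.1.1 • (q.2.1 : RVec 3) + q.1.2 • (q.2.2 : RVec 3)) :=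
    hFi.comp (by fun_prop)
  calc _ = ∫⁻ p : ℝ × ℝ, (∫⁻ q, F.indicator 1 (p.1 • (q.1 : RVec 3) + p.2 • (q.2 : RVec 3)) ∂(Λ.prod Λ))
        * (rayWeight α p.1 * rayWeight α p.2)
          ∂(((volume : Measure ℝ).restrict (Ioi 0)).prod ((volume : Measure ℝ).restrict (Ioi 0))) := by
        rw [hR, ← hmp.lintegral_comp_emb (MeasurableEquiv.measurableEmbedding _)]
        refine lintegral_congr fun s => ?_
        rw [Fin.prod_univ_two]
        rfl
    _ = ∫⁻ q : USphere 3 × USphere 3, ∫⁻ p : ℝ × ℝ, F.indicator 1 (p.1 • (q.1 : RVec 3) + p.2 • (q.2 : RVec 3))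
        * (rayWeight α p.1 * rayWeight α p.2)
          ∂(((volume : Measure ℝ).restrict (Ioi 0)).prod ((volume : Measure ℝ).restrict (Ioi 0))) ∂(Λ.prod Λ) := by
        rw [← lintegral_lintegral_swap]
        · refine lintegral_congr fun p => ?_
          rw [lintegral_mul_const]
          exact hm3.comp measurable_prodMk_left
        · refine Measurable.aemeasurable ?_
          exact hm3.mul (by fun_prop)
    _ = _ := by
        rw [lintegral_prod]
        · refine lintegral_congr fun x => lintegral_congr fun y => ?_
          rw [lintegral_prod]
          · rfl
          · refine Measurable.aemeasurable ?_
            exact (hm3.comp measurable_prodMk_right).mul (by fun_prop)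
        · refine Measurable.aemeasurable (Measurable.lintegral_prod_right' (f := fun z : (USphere 3 × USphere 3) × (ℝ × ℝ) =>
            F.indicator 1 (z.2.1 • (z.1.1 : RVec 3) + z.2.2 • (z.1.2 : RVec 3))
              * (rayWeight α z.2.1 * rayWeight α z.2.2)) ?_)
          exact (hm3.comp measurable_swap).mul (by fun_prop)

theorem pairMass_comm (α : ℝ) {F : Set (RVec 3)} (hF : MeasurableSet F) (x y : USphere 3) :
    pairMass α F x y = pairMass α F y x := by
  have hFi : Measurable (F.indicator (1 : RVec 3 → ℝ≥0∞)) := measurable_one.indicator hF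
  rw [pairMass, pairMass, lintegral_lintegral_swap]
  · refine lintegral_congr fun s => lintegral_congr fun t => ?_
    rw [add_comm, mul_comm (rayWeight α t)]
  · refine Measurable.aemeasurable (Measurable.mul ?_ (by fun_prop))
    exact hFi.comp (by fun_prop)

theorem pairMass_eq_zero {α : ℝ} {F : Set (RVec 3)} {x y : USphere 3}
    (h : ∀ s t : ℝ, 0 < s → 0 < t → s • (x : RVec 3) + t • (y : RVec 3) ∉ F) : pairMass α F x y = 0 := by
  rw [pairMass, setLIntegral_congr_fun (g := fun _ => 0) measurableSet_Ioi fun s hs => ?_, lintegral_zero]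
  rw [setLIntegral_congr_fun (g := fun _ => 0) measurableSet_Ioi fun t ht => ?_, lintegral_zero]
  rw [indicator_of_notMem (h s t hs ht), zero_mul]

theorem tailL_mono {n : ℕ} (Λ : Measure (USphere n)) {E F : Set (RVec n)} (h : E ⊆ F) (k : ℕ) (α : ℝ) :
    tailL Λ E k α ≤ tailL Λ F k α := by
  unfold tailL
  gcongr

/-- The closed set `{x : x_1 ≥ 1, x_2 ≥ 1, x_3 ≤ 1}`. -/
def closedSetE : Set (RVec 3) := {x | 1 ≤ x 0 ∧ 1 ≤ x 1 ∧ x 2 ≤ 1}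

theorem isClosed_closedSetE : IsClosed closedSetE := by
  rw [closedSetE, ofPred_and, ofPred_and]
  exact (isClosed_le continuous_const (by fun_prop)).inter
    ((isClosed_le continuous_const (by fun_prop)).inter (isClosed_le (by fun_prop) continuous_const))

theorem isOpen_setE : IsOpen setE := by
  rw [setE, ofPred_and, ofPred_and]
  exact (isOpen_lt continuous_const (by fun_prop)).inter
    ((isOpen_lt continuous_const (by fun_prop)).inter (isOpen_lt (by fun_prop) continuous_const))

theorem closure_setE_subset : closure setE ⊆ closedSetE :=
  closure_minimal (fun _ hx => ⟨hx.1.le, hx.2.1.le, hx.2.2.le⟩) isClosed_closedSetE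

theorem ae_add_mul_ne {c d : ℝ} (h : d = 0 → c ≠ 1) : ∀ᵐ t : ℝ ∂(volume.restrict (Ioi 0)), c + t * d ≠ 1 := by
  rcases eq_or_ne d 0 with hd | hd
  · exact ae_of_all _ fun t => by simpa [hd] using h hd
  · filter_upwards [Measure.ae_ne (volume.restrict (Ioi (0 : ℝ))) ((1 - c) / d)] with t ht h1
    exact ht (by rw [eq_div_iff hd]; linarith)

/-- The two sets differ only where some coordinate equals `1`. For almost every `s` no `s x_i`
equals `1`; after that, for almost every `t`, no `s x_i + t y_i` does, even when `y_i = 0`. -/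
theorem pairMass_closedSetE (α : ℝ) (x y : USphere 3) : pairMass α closedSetE x y = pairMass α setE x y := by
  have hs : ∀ i : Fin 3, ∀ᵐ s : ℝ ∂(volume.restrict (Ioi 0)), 0 + s * (x : RVec 3) i ≠ 1 := fun i =>
    ae_add_mul_ne fun _ => zero_ne_one
  refine lintegral_congr_ae ?_
  filter_upwards [ae_all_iff.2 hs] with s hs
  refine lintegral_congr_ae ?_
  have ht : ∀ i : Fin 3, ∀ᵐ t : ℝ ∂(volume.restrict (Ioi 0)), s * (x : RVec 3) i + t * (y : RVec 3) i ≠ 1 :=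
    fun i => ae_add_mul_ne fun _ => by simpa using hs i
  filter_upwards [ae_all_iff.2 ht] with t ht
  congr 1
  have : s • (x : RVec 3) + t • (y : RVec 3) ∈ closedSetE ↔ s • (x : RVec 3) + t • (y : RVec 3) ∈ setE := by
    simp only [closedSetE, setE, mem_ofPred_eq, PiLp.add_apply, PiLp.smul_apply, smul_eq_mul]
    have h0 := ht 0
    have h1 := ht 1
    have h2 := ht 2
    constructor
    · rintro ⟨a, b, c⟩
      exact ⟨lt_of_le_of_ne a h0.symm, lt_of_le_of_ne b h1.symm, lt_of_le_of_ne c h2⟩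
    · rintro ⟨a, b, c⟩
      exact ⟨a.le, b.le, c.le⟩
  by_cases h : s • (x : RVec 3) + t • (y : RVec 3) ∈ setE
  · rw [indicator_of_mem h, indicator_of_mem (this.2 h)]
  · rw [indicator_of_notMem h, indicator_of_notMem (mt this.1 h)]

theorem tailL_interior_eq_tailL_closure {Λ : Measure (USphere 3)} [IsFiniteMeasure Λ] (α : ℝ) :
    tailL Λ (interior setE) 2 α = tailL Λ (closure setE) 2 α := by
  rw [isOpen_setE.interior_eq]
  refine le_antisymm (tailL_mono Λ subset_closure 2 α) ?_
  refine (tailL_mono Λ closure_setE_subset 2 α).trans ?_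
  rw [tailL_two_eq isClosed_closedSetE.measurableSet, tailL_two_eq isOpen_setE.measurableSet]
  simp_rw [pairMass_closedSetE]
  exact le_rfl

theorem lintegral_spectralMeas (α a : ℝ) (f : USphere 3 → ℝ≥0∞) :
    ∫⁻ x, f x ∂(spectralMeas α a) = ENNReal.ofReal (a ^ α * 3 ^ (α / 2) / 2) * (f diagDir + f (-diagDir))
      + ENNReal.ofReal ((1 - a ^ α) / 2) * (f (axisDir 0) + f (-axisDir 0) + (f (axisDir 1) + f (-axisDir 1))
        + (f (axisDir 2) + f (-axisDir 2))) := by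
  simp only [spectralMeas, lintegral_add_measure, lintegral_smul_measure, Fin.sum_univ_three, lintegral_dirac,
    smul_eq_mul]

theorem lintegral_rayWeight_Ioi {α c : ℝ} (h0 : 0 < α) (hc : 0 < c) :
    ∫⁻ t in Ioi c, rayWeight α t = ENNReal.ofReal (c ^ (-α)) := by
  have hi : IntegrableOn (fun t : ℝ => α * t ^ (-(1 + α))) (Ioi c) :=
    Integrable.const_mul (integrableOn_Ioi_rpow_of_lt (by linarith) hc) _
  have h := ofReal_integral_eq_lintegral_ofReal hi ((ae_restrict_iff' measurableSet_Ioi).2 (ae_of_all _ fun t ht => by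
    have : 0 < t := hc.trans ht
    positivity))
  unfold rayWeight
  rw [← h, integral_const_mul, integral_Ioi_rpow_of_lt (by linarith) hc, show -(1 + α) + 1 = -α by ring]
  congr 1
  field_simp

theorem diagDir_apply (i : Fin 3) : (diagDir : RVec 3) i = (Real.sqrt 3)⁻¹ := by
  simp [diagDir]

theorem axisDir_apply (i j : Fin 3) : (axisDir i : RVec 3) j = if j = i then 1 else 0 := by
  simp [axisDir]

theorem pairMass_axis_axis {α : ℝ} (h0 : 0 < α) : pairMass α setE (axisDir 0) (axisDir 1) = 1 := by
  have key : ∀ s t : ℝ, setE.indicator (1 : RVec 3 → ℝ≥0∞) (s • (axisDir 0 : RVec 3) + t • (axisDir 1 : RVec 3))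
      * (rayWeight α s * rayWeight α t)
      = (Ioi (1 : ℝ)).indicator (rayWeight α) s * (Ioi (1 : ℝ)).indicator (rayWeight α) t := by
    intro s t
    have hm : s • (axisDir 0 : RVec 3) + t • (axisDir 1 : RVec 3) ∈ setE ↔ 1 < s ∧ 1 < t := by
      simp [setE, axisDir_apply]
    by_cases h1 : 1 < s <;> by_cases h2 : 1 < t <;> simp [hm, h1, h2]
  have hone : ∫⁻ s in Ioi (0 : ℝ), (Ioi (1 : ℝ)).indicator (rayWeight α) s = 1 := by
    rw [setLIntegral_indicator measurableSet_Ioi, inter_eq_self_of_subset_left (Ioi_subset_Ioi zero_le_one),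
      lintegral_rayWeight_Ioi h0 one_pos]
    simp
  have hm : Measurable ((Ioi (1 : ℝ)).indicator (rayWeight α)) := (measurable_rayWeight α).indicator measurableSet_Ioi
  simp_rw [pairMass, key]
  simp_rw [lintegral_const_mul _ hm, lintegral_mul_const _ hm, hone, mul_one]

/-- Membership in `E` means `s > √3` and `t > s / √3 - 1`. The integral over `t` is the tail `(s /
√3 - 1) ^ (-α)`, and `s = √3 v` leaves the Beta integrand; the factor `3 ^ (-(α / 2))` later cancels
the mass of the diagonal atom. -/
theorem pairMass_diag_axis {α : ℝ} (h0 : 0 < α) : pairMass α setE diagDir (-axisDir 2)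
    = ENNReal.ofReal (α * 3 ^ (-(α / 2))) * ∫⁻ v in Ioi (1 : ℝ), ENNReal.ofReal (v ^ (-(1 + α)) * (v - 1) ^ (-α)) := by
  have h3 : 0 < Real.sqrt 3 := by positivity
  have hneg : ((-axisDir 2 : USphere 3) : RVec 3) = -(axisDir 2 : RVec 3) := rfl
  have hinner : ∀ s : ℝ, ∫⁻ t in Ioi (0 : ℝ), setE.indicator (1 : RVec 3 → ℝ≥0∞)
      (s • (diagDir : RVec 3) + t • ((-axisDir 2 : USphere 3) : RVec 3)) * (rayWeight α s * rayWeight α t)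
      = (Ioi (Real.sqrt 3)).indicator
        (fun s => rayWeight α s * ENNReal.ofReal (((Real.sqrt 3)⁻¹ * s - 1) ^ (-α))) s := by
    intro s
    have hm : ∀ t, s • (diagDir : RVec 3) + t • ((-axisDir 2 : USphere 3) : RVec 3) ∈ setE
        ↔ Real.sqrt 3 < s ∧ (Real.sqrt 3)⁻¹ * s - 1 < t := by
      intro t
      have e : Real.sqrt 3 < s ↔ 1 < s * (Real.sqrt 3)⁻¹ := by rw [lt_mul_inv_iff₀ h3, one_mul]
      simp only [setE, mem_ofPred_eq, PiLp.add_apply, PiLp.smul_apply, smul_eq_mul, diagDir_apply, e,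
        hneg, PiLp.neg_apply, axisDir_apply]
      simp
      intro _
      constructor <;> intro _ <;> linarith
    by_cases hs : Real.sqrt 3 < s
    · have hc : 0 < (Real.sqrt 3)⁻¹ * s - 1 := by
        rw [sub_pos, lt_inv_mul_iff₀ h3, mul_one]; exact hs
      rw [indicator_of_mem (mem_Ioi.2 hs), ← lintegral_rayWeight_Ioi h0 hc,
        ← lintegral_const_mul _ (measurable_rayWeight α)]
      rw [← inter_eq_self_of_subset_left (Ioi_subset_Ioi hc.le), ← setLIntegral_indicator measurableSet_Ioi]
      refine lintegral_congr fun t => ?_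
      by_cases ht : (Real.sqrt 3)⁻¹ * s - 1 < t
      · rw [indicator_of_mem ((hm t).2 ⟨hs, ht⟩), indicator_of_mem (mem_Ioi.2 ht), Pi.one_apply, one_mul]
      · rw [indicator_of_notMem fun h => ht ((hm t).1 h).2, indicator_of_notMem (by exact ht), zero_mul]
    · rw [indicator_of_notMem (by simpa using hs)]
      have : ∀ t : ℝ, setE.indicator (1 : RVec 3 → ℝ≥0∞)
          (s • (diagDir : RVec 3) + t • ((-axisDir 2 : USphere 3) : RVec 3)) = 0 := fun t =>
        indicator_of_notMem (fun h => hs ((hm t).1 h).1) _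
      simp only [this, zero_mul, lintegral_zero]
  simp_rw [pairMass, hinner]
  rw [setLIntegral_indicator measurableSet_Ioi, inter_eq_self_of_subset_left (Ioi_subset_Ioi h3.le),
    ← lintegral_const_mul' _ _ ENNReal.ofReal_ne_top]
  have himg : Ioi (Real.sqrt 3) = (fun v => Real.sqrt 3 * v) '' Ioi 1 := by
    rw [image_mul_left_Ioi h3, mul_one]
  rw [himg, lintegral_image_eq_lintegral_abs_deriv_mul (f' := fun _ => Real.sqrt 3) measurableSet_Ioi
    (fun v _ => by simpa using ((hasDerivAt_id v).const_mul (Real.sqrt 3)).hasDerivWithinAt)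
    (fun v _ w _ h => mul_left_cancel₀ h3.ne' h)]
  refine setLIntegral_congr_fun measurableSet_Ioi fun v hv => ?_
  have hv0 : 0 < v := lt_trans one_pos hv
  have hv1 : 0 < v - 1 := sub_pos.2 hv
  rw [inv_mul_cancel_left₀ h3.ne', rayWeight, abs_of_pos h3, ← ENNReal.ofReal_mul (by positivity),
    ← ENNReal.ofReal_mul h3.le, ← ENNReal.ofReal_mul (by positivity)]
  congr 1
  rw [Real.mul_rpow h3.le hv0.le]
  have e : Real.sqrt 3 ^ (-(1 + α)) * Real.sqrt 3 = 3 ^ (-(α / 2)) := by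
    rw [← Real.rpow_add_one h3.ne', Real.sqrt_eq_rpow, ← Real.rpow_mul (by norm_num)]
    congr 1; ring
  rw [← e]
  ring

/-- Of the 64 ordered pairs of atoms only `(e₁, e₂)`, `(d, -e₃)` and their transposes reach `E`,
with `d` the diagonal direction. -/
theorem lintegral_pairMass_setE {α a : ℝ} (h0 : 0 < α) :
    ∫⁻ x, ∫⁻ y, pairMass α setE x y ∂(spectralMeas α a) ∂(spectralMeas α a)
      = 2 * (ENNReal.ofReal ((1 - a ^ α) / 2) * ENNReal.ofReal ((1 - a ^ α) / 2))
        + 2 * (ENNReal.ofReal (a ^ α * 3 ^ (α / 2) / 2) * ENNReal.ofReal ((1 - a ^ α) / 2)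
          * pairMass α setE diagDir (-axisDir 2)) := by
  have hm := isOpen_setE.measurableSet
  have z : ∀ x y : USphere 3,
      (∀ s t : ℝ, 0 < s → 0 < t → ¬ (1 < s * (x : RVec 3) 0 + t * (y : RVec 3) 0 ∧
        1 < s * (x : RVec 3) 1 + t * (y : RVec 3) 1 ∧ s * (x : RVec 3) 2 + t * (y : RVec 3) 2 < 1)) →
      pairMass α setE x y = 0 := fun x y h => pairMass_eq_zero fun s t hs ht hmem => h s t hs ht (by
        simpa only [setE, mem_ofPred_eq, PiLp.add_apply, PiLp.smul_apply, smul_eq_mul] using hmem)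
  have h3 : 0 < (Real.sqrt 3)⁻¹ := by positivity
  have e10 : pairMass α setE (axisDir 1) (axisDir 0) = 1 := by
    rw [pairMass_comm α hm, pairMass_axis_axis h0]
  have e2d : pairMass α setE (-axisDir 2) diagDir = pairMass α setE diagDir (-axisDir 2) := pairMass_comm α hm _ _
  simp only [lintegral_spectralMeas]
  rw [e10, e2d, pairMass_axis_axis h0]
  generalize hk : pairMass α setE diagDir (-axisDir 2) = k
  -- For every other pair the three inequalities defining `E` are incompatible with `s, t > 0`; the
  -- discharger checks this by linear arithmetic with `s / √3` and `t / √3` positive.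
  simp (disch := (
    intro s t hs ht
    have p1 := mul_pos hs h3
    have p2 := mul_pos ht h3
    simp [diagDir_apply, axisDir_apply]
    try (intros; with_unfolding_all linarith))) only [z]
  simp only [mul_zero, zero_add, add_zero]
  ring

end TailFunctional

/-! ### Values of `L` on the interior and on thickenings of `E`. -/

section Values

open Set

theorem tailL_interior_setE {α a : ℝ} (h0 : 0 < α) :
    tailL (spectralMeas α a) (interior setE) 2 α = ENNReal.ofReal (tailConst α ^ 2 / 2) *
      (2 * (ENNReal.ofReal ((1 - a ^ α) / 2) * ENNReal.ofReal ((1 - a ^ α) / 2))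
        + 2 * (ENNReal.ofReal (a ^ α * 3 ^ (α / 2) / 2) * ENNReal.ofReal ((1 - a ^ α) / 2)
          * (ENNReal.ofReal (α * 3 ^ (-(α / 2))) *
            ∫⁻ v in Ioi (1 : ℝ), ENNReal.ofReal (v ^ (-(1 + α)) * (v - 1) ^ (-α))))) := by
  have := isFiniteMeasure_spectralMeas α a
  rw [isOpen_setE.interior_eq, tailL_two_eq isOpen_setE.measurableSet, lintegral_pairMass_setE h0,
    pairMass_diag_axis h0]

theorem tailL_interior_setE_of_lt_one {α a : ℝ} (h0 : 0 < α) (h1 : α < 1) (ha0 : 0 < a) (ha1 : a < 1) :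
    tailL (spectralMeas α a) (interior setE) 2 α = ENNReal.ofReal (limitConst α a) := by
  have hlt : a ^ α < 1 := Real.rpow_lt_one ha0.le ha1 h0
  have hb : 0 < 1 - a ^ α := by linarith
  have hG := Real.Gamma_pos_of_pos (by linarith : 0 < 2 * α)
  have hG1 := Real.Gamma_pos_of_pos (by linarith : 0 < 1 - α)
  have hG2 := Real.Gamma_pos_of_pos (by linarith : 0 < 1 + α)
  have h2 : (2 : ℝ≥0∞) = ENNReal.ofReal 2 := by norm_num
  rw [tailL_interior_setE h0, lintegral_Ioi_one_beta h0 h1, h2]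
  rw [← ENNReal.ofReal_mul (by positivity), ← ENNReal.ofReal_mul (by positivity),
    ← ENNReal.ofReal_mul (by positivity), ← ENNReal.ofReal_mul (by positivity),
    ← ENNReal.ofReal_mul (by positivity), ← ENNReal.ofReal_mul (by positivity),
    ← ENNReal.ofReal_add (by positivity) (by positivity), ← ENNReal.ofReal_mul (by positivity)]
  congr 1
  rw [limitConst, Real.rpow_neg (by norm_num)]
  have : (0 : ℝ) < 3 ^ (α / 2) := by positivity
  field_simp
  ring

theorem tailL_interior_setE_eq_top {α a : ℝ} (h1 : 1 ≤ α) (h2 : α < 2) (ha0 : 0 < a) (ha1 : a < 1) :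
    tailL (spectralMeas α a) (interior setE) 2 α = ⊤ := by
  have h0 : 0 < α := by linarith
  have hlt : a ^ α < 1 := Real.rpow_lt_one ha0.le ha1 h0
  have hb : 0 < 1 - a ^ α := by linarith
  have hC := tailConst_pos h0 h2
  have e1 : ENNReal.ofReal (tailConst α ^ 2 / 2) ≠ 0 := by
    rw [Ne, ENNReal.ofReal_eq_zero, not_le]; positivity
  have e2 : ENNReal.ofReal ((1 - a ^ α) / 2) ≠ 0 := by
    rw [Ne, ENNReal.ofReal_eq_zero, not_le]; positivity
  have e3 : ENNReal.ofReal (a ^ α * 3 ^ (α / 2) / 2) ≠ 0 := by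
    rw [Ne, ENNReal.ofReal_eq_zero, not_le]; positivity
  have e4 : ENNReal.ofReal (α * 3 ^ (-(α / 2))) ≠ 0 := by
    rw [Ne, ENNReal.ofReal_eq_zero, not_le]; positivity
  rw [tailL_interior_setE h0, lintegral_Ioi_one_beta_eq_top h1, ENNReal.mul_top e4,
    ENNReal.mul_top (mul_ne_zero e3 e2), ENNReal.mul_top two_ne_zero, add_top, ENNReal.mul_top e1]

theorem lintegral_rayWeight_Ioo_eq_top {α ε : ℝ} (h0 : 0 < α) (hε : 0 < ε) :
    ∫⁻ t in Ioo 0 ε, rayWeight α t = ⊤ := by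
  by_contra hc
  have hi : IntegrableOn (fun t : ℝ => α * t ^ (-(1 + α))) (Ioo 0 ε) := by
    refine ⟨by fun_prop, ?_⟩
    rw [hasFiniteIntegral_iff_ofReal]
    · exact lt_top_iff_ne_top.2 hc
    · refine (ae_restrict_iff' measurableSet_Ioo).2 (ae_of_all _ fun t ht => ?_)
      have : 0 < t := ht.1
      positivity
  have hi2 : IntegrableOn (fun t : ℝ => t ^ (-(1 + α))) (Ioo 0 ε) := by
    have : IntegrableOn (fun t : ℝ => α⁻¹ * (α * t ^ (-(1 + α)))) (Ioo 0 ε) :=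
      Integrable.const_mul hi α⁻¹
    simpa only [inv_mul_cancel_left₀ h0.ne'] using this
  rw [intervalIntegral.integrableOn_Ioo_rpow_iff hε] at hi2
  linarith

theorem ones_mem_closure_setE : (WithLp.toLp 2 fun _ : Fin 3 => (1 : ℝ) : RVec 3) ∈ closure setE := by
  have hlim : Tendsto (fun η : ℝ => (WithLp.toLp 2 ![1 + η, 1 + η, 1 - η] : RVec 3)) (𝓝[>] 0)
      (𝓝 (WithLp.toLp 2 fun _ : Fin 3 => (1 : ℝ))) := by
    have hc : Continuous fun η : ℝ => (WithLp.toLp 2 ![1 + η, 1 + η, 1 - η] : RVec 3) := by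
      refine (PiLp.continuous_toLp 2 _).comp (continuous_pi fun i => ?_)
      fin_cases i
      · exact continuous_const.add continuous_id
      · exact continuous_const.add continuous_id
      · exact continuous_const.sub continuous_id
    have := hc.tendsto 0
    have e : (![1 + 0, 1 + 0, 1 - 0] : Fin 3 → ℝ) = fun _ => 1 := by
      ext i; fin_cases i <;> simp
    rw [e] at this
    exact this.mono_left nhdsWithin_le_nhds
  refine mem_closure_of_tendsto hlim ?_
  filter_upwards [self_mem_nhdsWithin] with η hη
  have : 0 < η := hη
  simp [setE, this]

/-- At `s = √3`, `t = 0` the combination is the point `(1, 1, 1)`, so an open set containing it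
contains the combinations for all `s` slightly above `√3` and all small `t > 0`. The weight `t ^
(-(1 + α))` has infinite mass near `0`. -/
theorem pairMass_eq_top {α : ℝ} (h0 : 0 < α) {F : Set (RVec 3)} (hF : IsOpen F)
    (h : (WithLp.toLp 2 fun _ : Fin 3 => (1 : ℝ) : RVec 3) ∈ F) : pairMass α F diagDir (axisDir 0) = ⊤ := by
  have h3 : 0 < Real.sqrt 3 := by positivity
  have hc : Continuous fun p : ℝ × ℝ => p.1 • (diagDir : RVec 3) + p.2 • (axisDir 0 : RVec 3) := by fun_prop
  have hmem : (fun p : ℝ × ℝ => p.1 • (diagDir : RVec 3) + p.2 • (axisDir 0 : RVec 3)) (Real.sqrt 3, 0) ∈ F := by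
    have e : Real.sqrt 3 • (diagDir : RVec 3) + (0 : ℝ) • (axisDir 0 : RVec 3)
        = (WithLp.toLp 2 fun _ : Fin 3 => (1 : ℝ) : RVec 3) := by
      rw [zero_smul, add_zero, diagDir, smul_smul, mul_inv_cancel₀ h3.ne', one_smul]
    change Real.sqrt 3 • (diagDir : RVec 3) + (0 : ℝ) • (axisDir 0 : RVec 3) ∈ F
    rw [e]
    exact h
  obtain ⟨ε, hε, hball⟩ := Metric.isOpen_iff.1 (hF.preimage hc) _ hmem
  have hin : ∀ s ∈ Ioo (Real.sqrt 3) (Real.sqrt 3 + ε), ∀ t ∈ Ioo 0 ε,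
      s • (diagDir : RVec 3) + t • (axisDir 0 : RVec 3) ∈ F := by
    intro s hs t ht
    have hst : ((s, t) : ℝ × ℝ) ∈ Metric.ball (Real.sqrt 3, 0) ε := by
      rw [Metric.mem_ball, Prod.dist_eq, max_lt_iff, Real.dist_eq, Real.dist_eq, abs_lt, abs_lt]
      exact ⟨⟨by linarith [hs.1], by linarith [hs.2]⟩, by linarith [ht.1], by linarith [ht.2]⟩
    exact hball hst
  rw [eq_top_iff]
  calc (⊤ : ℝ≥0∞) = ∫⁻ s in Ioo (Real.sqrt 3) (Real.sqrt 3 + ε), ⊤ := by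
        rw [setLIntegral_const, Real.volume_Ioo, ENNReal.top_mul]
        simpa using hε
    _ ≤ ∫⁻ s in Ioo (Real.sqrt 3) (Real.sqrt 3 + ε), ∫⁻ t in Ioi (0 : ℝ),
        F.indicator 1 (s • (diagDir : RVec 3) + t • (axisDir 0 : RVec 3)) * (rayWeight α s * rayWeight α t) := by
        refine setLIntegral_mono' measurableSet_Ioo fun s hs => ?_
        have hs0 : 0 < s := h3.trans hs.1
        have hw : rayWeight α s ≠ 0 := by
          rw [rayWeight, Ne, ENNReal.ofReal_eq_zero, not_le]; positivity
        calc (⊤ : ℝ≥0∞) = ∫⁻ t in Ioo 0 ε, rayWeight α s * rayWeight α t := by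
              rw [lintegral_const_mul _ (measurable_rayWeight α), lintegral_rayWeight_Ioo_eq_top h0 hε,
                ENNReal.mul_top hw]
          _ = ∫⁻ t in Ioo 0 ε, F.indicator 1 (s • (diagDir : RVec 3) + t • (axisDir 0 : RVec 3))
                * (rayWeight α s * rayWeight α t) := by
              refine setLIntegral_congr_fun measurableSet_Ioo fun t ht => ?_
              rw [indicator_of_mem (hin s hs t ht), Pi.one_apply, one_mul]
          _ ≤ _ := lintegral_mono_set Ioo_subset_Ioi_self
    _ ≤ _ := lintegral_mono_set fun s hs => h3.trans hs.1

/-- The corner `(1, 1, 1)` lies in the closure of `E`, hence in every thickening, so the pair formed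
by the diagonal and `e₁` already contributes `∞`; both atoms have positive mass since `0 < a < 1`.
-/
theorem tailL_thickening_eq_top {α a δ : ℝ} (h0 : 0 < α) (h2 : α < 2) (ha0 : 0 < a) (ha1 : a < 1) (hδ : 0 < δ) :
    tailL (spectralMeas α a) (Metric.thickening δ setE) 2 α = ⊤ := by
  have := isFiniteMeasure_spectralMeas α a
  have hlt : a ^ α < 1 := Real.rpow_lt_one ha0.le ha1 h0
  have hb : 0 < 1 - a ^ α := by linarith
  have hC := tailConst_pos h0 h2
  have e1 : ENNReal.ofReal (tailConst α ^ 2 / 2) ≠ 0 := by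
    rw [Ne, ENNReal.ofReal_eq_zero, not_le]; positivity
  have e2 : ENNReal.ofReal ((1 - a ^ α) / 2) ≠ 0 := by
    rw [Ne, ENNReal.ofReal_eq_zero, not_le]; positivity
  have e3 : ENNReal.ofReal (a ^ α * 3 ^ (α / 2) / 2) ≠ 0 := by
    rw [Ne, ENNReal.ofReal_eq_zero, not_le]; positivity
  have htop := pairMass_eq_top h0 Metric.isOpen_thickening
    (Metric.closure_subset_thickening hδ setE ones_mem_closure_setE)
  rw [tailL_two_eq Metric.isOpen_thickening.measurableSet, lintegral_spectralMeas, lintegral_spectralMeas α a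
    (fun y => pairMass α (Metric.thickening δ setE) diagDir y), htop]
  simp only [top_add, ENNReal.mul_top e2, add_top, ENNReal.mul_top e3, ENNReal.mul_top e1]

end Values

theorem mainTheorem5 {Ω : Type*} [MeasurableSpace Ω] (P : Measure Ω) [IsProbabilityMeasure P]
    (α a : ℝ) (hα0 : 0 < α) (hα2 : α < 2) (ha0 : 0 < a) (ha1 : a < 1)
    (S : Fin 4 → Ω → ℝ) (hS_meas : ∀ i, Measurable (S i)) (hS_indep : iIndepFun S P)
    (hS_law : ∀ i, IsStdStable α (P.map (S i))) :
    -- `C_α` is the tail constant of `S_α`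
    (0 < tailConst α ∧
      Tendsto (fun h : ℝ => h ^ α * P.real {ω | h ≤ S 0 ω}) atTop (𝓝 (tailConst α / 2))) ∧
    -- the eight point measure is the spectral measure of `X`
    IsSpectralMeasure α (P.map (vecX α a S)) (spectralMeas α a) ∧
    -- the exact decay for `α < 1`
    (α < 1 →
      Tendsto (fun h : ℝ => h ^ (2 * α) * P.real {ω | vecX α a S ω ∈ h • setE}) atTop
        (𝓝 (limitConst α a))) ∧
    -- the values of `L`
    Tendsto (fun δ : ℝ => tailL (spectralMeas α a) (Metric.thickening δ setE) 2 α)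
      (𝓝[>] 0) (𝓝 ⊤) ∧
    tailL (spectralMeas α a) (interior setE) 2 α = tailL (spectralMeas α a) (closure setE) 2 α ∧
    (1 ≤ α → tailL (spectralMeas α a) (interior setE) 2 α = ⊤) ∧
    (α < 1 → tailL (spectralMeas α a) (interior setE) 2 α = ENNReal.ofReal (limitConst α a)) := by
  have := isFiniteMeasure_spectralMeas α a
  refine ⟨⟨tailConst_pos hα0 hα2, ?_⟩, isSpectralMeasure_spectralMeas P hα0 ha0 ha1 hS_meas hS_indep hS_law,
    fun h1 => tendsto_rpow_mul_measureReal_vecX P hα0 h1 ha0 ha1 hS_meas hS_indep hS_law, ?_,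
    tailL_interior_eq_tailL_closure α, fun h1 => tailL_interior_setE_eq_top h1 hα2 ha0 ha1,
    fun h1 => tailL_interior_setE_of_lt_one hα0 h1 ha0 ha1⟩
  · refine (tendsto_rpow_mul_measureReal_Ici hα0 hα2 (hS_law 0)).congr fun h => ?_
    rw [map_measureReal_apply (hS_meas 0) measurableSet_Ici]
    rfl
  -- The functional already equals `∞` for each `δ > 0`, so the limit is that of a constant.
  · refine tendsto_const_nhds.congr' ?_
    filter_upwards [self_mem_nhdsWithin] with δ hδ
    exact (tailL_thickening_eq_top hα0 hα2 ha0 ha1 hδ).symm
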